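/- Fix a linear order on an alphabet, and compare strings lexicographically. A string $w$ is *primitive* if it is not of the form $v^k$ with $k\ge 2$; two strings are *equivalent* if one is a rotation of the other. For a primitive string $w$ with $|w|\ge 2$ let $w_{\min}$ and $w_{\max}$ be its lexicographically smallest and largest rotations, and write $w_{\min}=p_{\min}p_{\max}$, $w_{\max}=p_{\max}p_{\min}$. The *nice rotation* of $w$ is $w_{\max}$ if $|p_{\max}|\le|p_{\min}|$, and $w_{\min}$ otherwise; $w$ is *nice* if it is its own nice rotation. A *$w$-string* is a prefix of the infinite string $w^\infty=www\cdots$. The overlap $\mathrm{ov}(u,v)$ is the longest suffix of $u$ that is also a prefix of $v$. Let $(w_i)_{i\in I}$ be pairwise non-equivalent nice strings and let $x_i$ be a $w_i$-string for every $i\in I$. The overlap graph is the complete directed graph on the $x_i$ (without loops) in which the edge from $x_i$ to $x_j$ has weight $|\mathrm{ov}(x_i,x_j)|$. Let $C=x_{i_1}\to x_{i_2}\to\dots\to x_{i_k}\to x_{i_1}$ be a cycle in it, with $k\ge 2$ and $i_1,\dots,i_k$ distinct. Let $O_C$ be the sum and $M_C$ the minimum of the weights of the edges of $C$, and let $L_C=\sum_{j=1}^k|w_{i_j}|$.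 Then $$2M_C+7O_C\le 11L_C .$$ If moreover $|x_{i_j}|\ge|w_{i_j}|$ for all $j$, the same inequality holds with $L_C$ replaced by the sum of the minimum periods of the strings $x_{i_1},\dots,x_{i_k}$. The bound is essentially tight: over any alphabet with at least two letters, and for $k=2$ as well as for $k=3$, there is a constant $D$ such that there are $k$-cycles of this kind (with $|x_i|\ge|w_i|$ for all $i$) whose sum of minimum periods $L_C$ is arbitrarily large and which satisfy $2M_C+7O_C\ge 11L_C-D$. -/

import Mathlib

namespace Superstring

variable {α : Type*}

/-- The power `v ^ k`: the concatenation of `k` copies of the string `v`. -/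
def strPow (v : List α) (k : ℕ) : List α := (List.replicate k v).flatten

/-- `w` is primitive: it is not `v ^ k` for any string `v` and any `k ≥ 2`. -/
def IsPrimitive (w : List α) : Prop :=
  ∀ (v : List α) (k : ℕ), 2 ≤ k → w ≠ strPow v k

/-- Two strings are equivalent if one is a rotation of the other. -/
def Equivalent (u v : List α) : Prop := u ~r v

/-- `p` is a period of `w`: `1 ≤ p ≤ |w|` and `w[i] = w[i + p]` whenever both sides exist. -/
def IsPeriod (w : List α) (p : ℕ) : Prop :=
  1 ≤ p ∧ p ≤ w.length ∧ w.HasPeriod p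

/-- The (minimum) period of a nonempty string. -/
noncomputable def period (w : List α) : ℕ := sInf {p | IsPeriod w p}

/-- `x` is a `w`-string: a prefix of the semi-infinite string `w ^ ∞ = www…`. -/
def IsWString (w x : List α) : Prop := ∃ n : ℕ, x <+: strPow w n

section Order

variable [LinearOrder α]

/-- `z` is the lexicographically minimal rotation of `w`. -/
def IsMinRotation (w z : List α) : Prop := w ~r z ∧ ∀ z', w ~r z' → z ≤ z'

/-- `z` is the lexicographically maximal rotation of `w`. -/
def IsMaxRotation (w z : List α) : Prop := w ~r z ∧ ∀ z', w ~r z' → z' ≤ z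

/-- `z` is the nice rotation of `w`. Here `w_min = pmin pmax` and `w_max = pmax pmin`, which
determines the strings `pmin` and `pmax` when `w` is primitive of length at least two; the nice
rotation is `w_max` if `|pmax| ≤ |pmin|`, and `w_min` otherwise. -/
def IsNiceRotation (w z : List α) : Prop :=
  ∃ pmin pmax : List α,
    IsMinRotation w (pmin ++ pmax) ∧ IsMaxRotation w (pmax ++ pmin) ∧
      z = if pmax.length ≤ pmin.length then pmax ++ pmin else pmin ++ pmax

/-- A nice string: a primitive string of length at least two that is its own nice rotation. -/
def IsNice (w : List α) : Prop :=
  2 ≤ w.length ∧ IsPrimitive w ∧ IsNiceRotation w w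

end Order

section Overlap

variable [DecidableEq α]

/-- The overlap of `u` and `v`: the longest suffix of `u` that is also a prefix of `v`. -/
def overlap (u v : List α) : List α :=
  v.take (Nat.findGreatest (fun n => v.take n <:+ u) v.length)

/-- The weight `|ov(u, v)|` of the edge `(u, v)` of the overlap graph. -/
def overlapWeight (u v : List α) : ℕ := (overlap u v).length

/-- The total overlap of the cycle `y 0 → y 1 → ⋯ → y (k - 1) → y 0` in the overlap graph. -/
def totalOverlap {k : ℕ} (y : Fin k → List α) : ℕ :=
  ∑ i, overlapWeight (y i) (y (finRotate k i))

/-- The minimum weight of an edge of the cycle `y 0 → y 1 → ⋯ → y (k - 1) → y 0`. -/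
noncomputable def minOverlap {k : ℕ} (y : Fin k → List α) : ℕ :=
  ⨅ i, overlapWeight (y i) (y (finRotate k i))

end Overlap

/-- The sum of the periods of the strings on a cycle. -/
noncomputable def totalPeriod {k : ℕ} (y : Fin k → List α) : ℕ :=
  ∑ i, period (y i)

/-- `x i` is a `w i`-string for every `i`, where the `w i` are pairwise non-equivalent nice
strings. -/
structure IsNiceFamily [LinearOrder α] {ι : Type*} (w x : ι → List α) : Prop where
  nice : ∀ i, IsNice (w i)
  nonequiv : ∀ i j, i ≠ j → ¬ Equivalent (w i) (w j)
  wstring : ∀ i, IsWString (w i) (x i)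

end Superstring

/-!
Replace each nice string `w` by its infinite power, a periodic sequence. Its suffix at `0` is
lexicographically extreme among all suffixes, and the suffix at some position `p ≤ |w| / 2` is
extreme in the opposite direction (`NiceSeq`). An overlap of length `e` from a `u`-string to a
`v`-string exhibits a prefix of length `e` of `v ^ ∞` inside `u ^ ∞`. Extend it as far as the two
sequences agree; the letters at the first disagreement are then compared through the extremality of
suitably chosen suffixes. With `a = |u|`, `b = |v|` and `p`, `q` the positions of the second extreme
rotations, this gives

* `e < a + q` (`NiceSeq.overlap_lt`), and `e < b` if `a ≤ b` (`NiceSeq.overlap_lt_of_le`);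
* if `b ≤ a`, then `e + p ≤ a + b`, or else both `e + p ≤ a + q + b` and `p + 2 * b ≤ a + q`
  (`SeqOverlap.le_or`). This looks at the first two extreme positions of `u ^ ∞` that the overlap
  meets: at most one of them is followed by `b` letters of the overlap, and if one is, then the
  overlap is synchronised with `v ^ ∞` there.

Around a cycle these bounds imply `2 * M + 7 * O ≤ 11 * L` by linear arithmetic (`cycle_bound`). With
`M ≤ e` for every edge, the weighted slack of the bounds `e ≤ a + q` and `p ≤ a / 2` on an edge and
its two ends is at least `2 * M / 3` (`EdgeBound.two_mul_le`). As every node is on two edges, the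
total slack is at least `k * M / 3`, which settles cycles with `k ≥ 6` nodes; shorter cycles are
treated by distinguishing the kinds of their edges. Cycles with two nodes need one more fact: in the
second alternative above the reverse overlap is at most `b + q`, unless `3 * b ≤ a`
(`SeqOverlap.le_or_of_symm`). Since extreme rotations are unbordered, `|w|` is the least period of
every `w`-string of length at least `|w|` (`period_eq`), which gives the second form of the bound.

For the tightness, let `A = 1 0 ^ (m - 1)` and `B = 1 0 ^ m`, where `0 < 1` stand for two letters of
the alphabet. The cycles consist of strings for the nice rotations of the words `ABB`, `AB` for
`k = 2`, and `ABABBB`, `BABAB`, `AB` for `k = 3`.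
-/

namespace Superstring

/-! ### Extreme positions of periodic sequences -/

section Sequences

variable {α : Type*} {r : α → α → Prop} {f g h : ℕ → α} {a b e i p q : ℕ}

/-- The suffix of `f` starting at `i` is lexicographically extreme among all suffixes of `f`: the
largest one if `r` is `≤`, the smallest one if `r` is `≥`. At the first position where another
suffix differs, its letter is related by `r` to the letter of the suffix at `i`. -/
def Extreme (r : α → α → Prop) (f : ℕ → α) (i : ℕ) : Prop :=
  ∀ j m, (∀ n < m, f (j + n) = f (i + n)) → r (f (j + m)) (f (i + m))

/-- `f` is periodic, and `a` is its least positive period. -/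
structure PrimPeriodic (f : ℕ → α) (a : ℕ) : Prop where
  pos : 0 < a
  add_period (n : ℕ) : f (n + a) = f n
  dvd (d : ℕ) : (∀ n, f (n + d) = f n) → a ∣ d

/-- The infinite power of a nice word of length `a`: the suffix at `0` is extreme for `r`, and the
suffix at `p`, in the first half of the period, is extreme in the opposite direction. -/
structure NiceSeq (r : α → α → Prop) (f : ℕ → α) (a p : ℕ) : Prop extends PrimPeriodic f a where
  top : Extreme r f 0
  bot : Extreme (flip r) f p
  p_pos : 0 < p
  two_mul_p_le : 2 * p ≤ a

theorem add_mul_of_period (hf : ∀ n, f (n + a) = f n) (n k : ℕ) : f (n + a * k) = f n := by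
  induction k with
  | zero => simp
  | succ k ih => rw [Nat.mul_succ, ← Nat.add_assoc, hf, ih]

namespace PrimPeriodic

theorem add_mul (hf : PrimPeriodic f a) (n k : ℕ) : f (n + a * k) = f n :=
  add_mul_of_period hf.add_period n k

theorem mod (hf : PrimPeriodic f a) (n : ℕ) : f (n % a) = f n := by
  conv_rhs => rw [← Nat.mod_add_div n a]
  rw [hf.add_mul]

theorem congr_mod (hf : PrimPeriodic f a) {m n : ℕ} (hmn : m % a = n % a) : f m = f n := by
  rw [← hf.mod m, hmn, hf.mod]

theorem eq_of_block (hf : PrimPeriodic f a) {i j : ℕ} (H : ∀ n < a, f (i + n) = f (j + n))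
    (n : ℕ) : f (i + n) = f (j + n) := by
  have h1 := H (n % a) (Nat.mod_lt _ hf.pos)
  rwa [hf.congr_mod (m := i + n % a) (n := i + n) (by simp),
    hf.congr_mod (m := j + n % a) (n := j + n) (by simp)] at h1

theorem mod_eq (hf : PrimPeriodic f a) {i j : ℕ} (H : ∀ n < a, f (i + n) = f (j + n)) :
    i % a = j % a := by
  wlog hij : i ≤ j generalizing i j
  · exact (this (fun n hn => (H n hn).symm) (by omega)).symm
  have h1 : a ∣ j - i := by
    apply hf.dvd
    intro n
    have hai : i ≤ a * i := Nat.le_mul_of_pos_left i hf.pos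
    have h2 := hf.eq_of_block H (n + a * i - i)
    rw [show i + (n + a * i - i) = n + a * i by omega, hf.add_mul,
      show j + (n + a * i - i) = n + (j - i) + a * i by omega, hf.add_mul] at h2
    exact h2.symm
  exact ((Nat.modEq_iff_dvd' hij).2 h1)

theorem shift (hf : PrimPeriodic f a) (s : ℕ) : PrimPeriodic (fun n => f (s + n)) a where
  pos := hf.pos
  add_period n := by rw [← add_assoc, hf.add_period]
  dvd d hd := by
    have h1 : s % a = (s + d) % a := hf.mod_eq fun n _ => by
      rw [add_assoc, add_comm d n]; exact (hd n).symm
    have h2 : s ≡ s + d [MOD a] := h1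
    simpa using (Nat.modEq_iff_dvd' (Nat.le_add_right s d)).1 h2

theorem exists_ne (hf : PrimPeriodic f a) {i j : ℕ} (hij : j % a ≠ i % a) :
    ∃ n, f (j + n) ≠ f (i + n) ∧ ∀ l < n, f (j + l) = f (i + l) := by
  classical
  have : ∃ n, f (j + n) ≠ f (i + n) := by
    by_contra! H
    exact hij (hf.mod_eq fun n _ => H n)
  exact ⟨Nat.find this, Nat.find_spec this, fun l hl => not_not.1 (Nat.find_min this hl)⟩

end PrimPeriodic

namespace Extreme

theorem shift {s : ℕ} (hi : Extreme r f (s + i)) : Extreme r (fun n => f (s + n)) i := by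
  intro j m hm
  have := hi (s + j) m (fun n hn => by simpa [add_assoc] using hm n hn)
  simpa [add_assoc] using this

theorem congr_mod (hi : Extreme r f i) (hf : PrimPeriodic f a) {j : ℕ} (hij : i % a = j % a) :
    Extreme r f j := by
  have key : ∀ n, f (j + n) = f (i + n) := fun n => hf.congr_mod (by
    rw [Nat.add_mod, ← hij, ← Nat.add_mod])
  intro k m hm
  rw [key]
  exact hi k m fun n hn => by rw [hm n hn, key]

/-- If a prefix of an extreme suffix of `f` occurs in `h`, and the prefix of the same length of an
extreme suffix of `h` occurs in `f`, then these prefixes are equal. -/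
theorem prefix_eq (hr : ∀ ⦃u v⦄, r u v → r v u → u = v) {j c k l : ℕ} (hf : Extreme r f i)
    (hh : Extreme r h j) (hc : ∀ n < l, f (c + n) = h (j + n)) (hk : ∀ n < l, f (i + n) = h (k + n)) :
    ∀ n < l, h (k + n) = h (j + n) := by
  intro n
  induction n using Nat.strong_induction_on with
  | _ n ih =>
    intro hn
    have ih' : ∀ t < n, h (k + t) = h (j + t) := fun t ht => ih t ht (ht.trans hn)
    refine hr (hh k n ih') ?_
    rw [← hc n hn, ← hk n hn]
    refine hf c n fun t ht => ?_
    rw [hc t (ht.trans hn), hk t (ht.trans hn), ih' t ht]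

/-- Extreme rotations of primitive words are unbordered. -/
theorem unbordered (hr : ∀ ⦃u v⦄, r u v → r v u → u = v) (hh : Extreme r h i)
    (hb : PrimPeriodic h b) {t : ℕ} (ht : 0 < t) (htb : t < b) :
    ∃ n < b - t, h (i + t + n) ≠ h (i + n) := by
  by_contra! H
  have key : ∀ n, h (i + (b - t) + n) = h (i + n) := by
    intro n
    induction n using Nat.strong_induction_on with
    | _ n ih =>
      refine hr ?_ ?_
      · exact hh (i + (b - t)) n ih
      -- The suffix at `i + t` runs through the border and goes on with the suffix at `i`, one
      -- period later.
      · have h1 := hh (i + t) (b - t + n) fun l hl => ?_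
        · rwa [show i + t + (b - t + n) = i + n + b by omega, hb.add_period, ← add_assoc] at h1
        · rcases lt_or_ge l (b - t) with hlt | hge
          · exact H l hlt
          · obtain ⟨l, rfl⟩ := Nat.exists_eq_add_of_le hge
            rw [show i + t + (b - t + l) = i + l + b by omega, hb.add_period, ← add_assoc,
              ih l (by omega)]
  have h1 : i % b = (i + (b - t)) % b := hb.mod_eq fun n _ => (key n).symm
  have h2 : i ≡ i + (b - t) [MOD b] := h1
  have h3 := (Nat.modEq_iff_dvd' (Nat.le_add_right i (b - t))).1 h2
  have h4 := Nat.le_of_dvd (by omega) h3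
  omega

end Extreme

/-! ### Overlaps of periodic sequences -/

-- Here `g` and `h` have least periods `a` and `b`, they agree before position `e`, and they differ
-- at `e`.

variable {e x y d : ℕ}

/-- The overlap with a nice word is shorter than `a + q`: otherwise the letter of `h` at `e` would
have to lie on both sides of the letter at `e - a`, by the extremality of the suffixes of `h` at
`0` and at `q`. -/
theorem NiceSeq.overlap_lt (hr : ∀ ⦃u v⦄, r u v → r v u → u = v) (hh : NiceSeq r h b q)
    (hg : PrimPeriodic g a) (hag : ∀ n < e, g n = h n) (hne : g e ≠ h e) : e < a + q := by
  by_contra! he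
  have ha := hg.pos
  have hea : h (e - a) = g e := by
    rw [← hag _ (by omega), ← hg.add_period (e - a), Nat.sub_add_cancel (by omega)]
  have hshift : ∀ n, n + a < e → h (a + n) = h n := fun n hn => by
    rw [← hag (a + n) (by omega), add_comm a n, hg.add_period, hag n (by omega)]
  have h1 := hh.top a (e - a) fun n hn => by rw [hshift n (by omega), zero_add]
  have h2 := hh.bot (a + q) (e - a - q) fun n hn => by
    rw [show a + q + n = a + (q + n) by ring, hshift _ (by omega)]
  rw [show a + q + (e - a - q) = e by omega, show q + (e - a - q) = e - a by omega, hea] at h2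
  rw [show a + (e - a) = e by omega, zero_add, hea] at h1
  exact hne (hr h2 h1)

/-- A nice word does not occur in the infinite power of an inequivalent word of at most the same
length. -/
theorem NiceSeq.overlap_lt_of_le (hr : ∀ ⦃u v⦄, r u v → r v u → u = v) (hh : NiceSeq r h b q)
    (hg : PrimPeriodic g a) (hag : ∀ n < e, g n = h n) (hne : g e ≠ h e) (hab : a ≤ b) : e < b := by
  by_contra! he
  rcases hab.lt_or_eq with hlt | rfl
  · obtain ⟨n, hn, hn'⟩ := hh.top.unbordered hr hh.toPrimPeriodic hg.pos hlt
    apply hn'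
    rw [zero_add, zero_add, ← hag _ (by omega), ← hag _ (by omega), add_comm a n, hg.add_period]
  · apply hne
    rw [← hg.mod, ← hh.mod]
    exact hag _ ((Nat.mod_lt _ hg.pos).trans_le he)

/-- Opposite extreme positions of `g` cannot both be followed by `b` letters of the overlap. -/
theorem lt_add_of_extreme_of_extreme (hr : ∀ ⦃u v⦄, r u v → r v u → u = v)
    (hx : Extreme r g x) (hy : Extreme (flip r) g y) (hb : PrimPeriodic h b)
    (hag : ∀ n < e, g n = h n) (hne : g e ≠ h e) (hxe : x + b ≤ e) : e < y + b := by
  by_contra! hye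
  have hb0 := hb.pos
  have heb : g (e - b) = h e := by
    rw [hag _ (by omega), ← hb.add_period (e - b), Nat.sub_add_cancel (by omega)]
  have hshift : ∀ n, n + b < e → g (n + b) = g n := fun n hn => by
    rw [hag _ hn, hag n (by omega), hb.add_period]
  have h1 := hx (x + b) (e - b - x) fun n hn => by
    rw [show x + b + n = x + n + b by ring, hshift _ (by omega)]
  have h2 := hy (y + b) (e - b - y) fun n hn => by
    rw [show y + b + n = y + n + b by ring, hshift _ (by omega)]
  rw [show x + b + (e - b - x) = e by omega, show x + (e - b - x) = e - b by omega, heb] at h1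
  rw [show y + b + (e - b - y) = e by omega, show y + (e - b - y) = e - b by omega, heb] at h2
  exact hne (hr h1 h2)

/-- An extreme position of `g` cannot have `b` letters of the overlap on both sides. -/
theorem lt_add_of_extreme_of_le (hr : ∀ ⦃u v⦄, r u v → r v u → u = v)
    (hx : Extreme r g x) (hb : PrimPeriodic h b)
    (hag : ∀ n < e, g n = h n) (hne : g e ≠ h e) (hxb : b ≤ x) : e < x + b := by
  by_contra! hxe
  have hb0 := hb.pos
  have heb : g (e - b) = h e := by
    rw [hag _ (by omega), ← hb.add_period (e - b), Nat.sub_add_cancel (by omega)]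
  have hshift : ∀ n, n + b < e → g (n + b) = g n := fun n hn => by
    rw [hag _ hn, hag n (by omega), hb.add_period]
  have h1 := hx (x + b) (e - b - x) fun n hn => by
    rw [show x + b + n = x + n + b by ring, hshift _ (by omega)]
  have h2 := hx (x - b) (e - x) fun n hn => by
    rw [← hshift (x - b + n) (by omega), show x - b + n + b = x + n by omega]
  rw [show x + b + (e - b - x) = e by omega, show x + (e - b - x) = e - b by omega, heb] at h1
  rw [show x - b + (e - x) = e - b by omega, show x + (e - x) = e by omega, heb] at h2
  exact hne (hr h1 h2)

/-- An extreme position of `g` followed by `b` letters of the overlap is an extreme position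
of `h`. -/
theorem mod_eq_of_extreme (hr : ∀ ⦃u v⦄, r u v → r v u → u = v)
    (hx : Extreme r g x) (hy : Extreme r h y) (hb : PrimPeriodic h b)
    (hag : ∀ n < e, g n = h n) (hxe : x + b ≤ e) (hye : y + b ≤ e) : x % b = y % b :=
  hb.mod_eq (hx.prefix_eq hr hy (fun n hn => hag (y + n) (by omega))
    fun n hn => hag (x + n) (by omega))

/-- The case in which the first extreme position `x` of `g` has the direction in which `h` is extreme
at `0`. If `b` letters of the overlap follow it, then `x = 0`, and fewer than `b` letters follow the
second extreme position `y`. -/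
theorem overlap_le_of_same_first (hr : ∀ ⦃u v⦄, r u v → r v u → u = v)
    (hx : Extreme r g x) (hy : Extreme (flip r) g y) (hh : NiceSeq r h b q)
    (hag : ∀ n < e, g n = h n) (hne : g e ≠ h e)
    (hyx : y = x + d) (hd : d + p ≤ a) (hxp : x + p ≤ a) : e + p ≤ a + b := by
  have hb := hh.toPrimPeriodic
  have hb0 := hb.pos
  by_contra! he
  have hxe : x + b ≤ e := by omega
  have hxb : x < b := by
    by_contra! hxb
    have := lt_add_of_extreme_of_le hr hx hb hag hne hxb
    omega
  have h1 := mod_eq_of_extreme hr hx hh.top hb hag hxe (by omega)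
  rw [Nat.mod_eq_of_lt hxb, Nat.zero_mod] at h1
  have := lt_add_of_extreme_of_extreme hr hx hy hb hag hne hxe
  omega

/-- The case in which the first extreme position `y` of `g` has the direction opposite to the one in
which `h` is extreme at `0`. If the first alternative fails, then `y = q`, and the second extreme
position `x = y + d` of `g` is a multiple of `b`. -/
theorem overlap_le_of_opposite_first (hr : ∀ ⦃u v⦄, r u v → r v u → u = v)
    (hg : PrimPeriodic g a) (hx : Extreme r g x) (hy : Extreme (flip r) g y)
    (hh : NiceSeq r h b q) (hag : ∀ n < e, g n = h n) (hne : g e ≠ h e) (hba : b ≤ a)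
    (hxy : x = y + d) (hd : d + p ≤ a) (hyp : y + p ≤ a) (hp : 2 * p ≤ a)
    (hdp : d = p ∨ d + p = a) :
    e + p ≤ a + b ∨ (e < q + d + b ∧ 2 * b ≤ q + d ∧ q + b ≤ e) := by
  have hb := hh.toPrimPeriodic
  have hb0 := hb.pos
  have hq := hh.two_mul_p_le
  have hr' : ∀ ⦃u v⦄, flip r u v → flip r v u → u = v := fun u v h1 h2 => hr h2 h1
  by_contra! hcon
  obtain ⟨he, hcon⟩ := hcon
  have hye : y + b ≤ e := by omega
  have hqe : q + b ≤ e := by omega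
  have hyb : y < b := by
    by_contra! hyb
    have := lt_add_of_extreme_of_le hr' hy hb hag hne hyb
    omega
  have h1 := mod_eq_of_extreme hr' hy hh.bot hb hag hye hqe
  have h2 := lt_add_of_extreme_of_extreme hr' hy hx hb hag hne hye
  rw [Nat.mod_eq_of_lt hyb, Nat.mod_eq_of_lt (by omega)] at h1
  subst h1
  have h3 := hh.overlap_lt hr hg hag hne
  by_cases hxb : x % b = 0 % b
  · obtain ⟨m, hm⟩ := (Nat.dvd_of_mod_eq_zero (by simpa using hxb))
    rcases Nat.lt_or_ge m 2 with hm2 | hm2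
    · interval_cases m <;> omega
    · have : b * 2 ≤ b * m := Nat.mul_le_mul_left b hm2
      omega
  · obtain ⟨m, hm, hm'⟩ := hb.exists_ne hxb
    have h4 : ∀ n < e - x, h (x + n) = h (0 + n) :=
      hx.prefix_eq hr hh.top (fun n hn => by rw [zero_add]; exact hag _ (by omega))
        fun n hn => hag _ (by omega)
    have h5 : e - x ≤ m := by
      by_contra! hlt
      exact hm (h4 m hlt)
    -- By extremality at `0` and at `y`, the first difference between the suffixes of `h` at `x` and
    -- at `0` comes before `y` letters.
    have h6 : m < y := by
      by_contra! hle
      apply hm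
      refine hr (hh.top x m hm') ?_
      have := hh.bot (x + y) (m - y) fun n hn => by
        have := hm' (y + n) (by omega)
        rwa [zero_add, ← add_assoc] at this
      rw [show x + y + (m - y) = x + m by omega, show y + (m - y) = m by omega] at this
      rwa [zero_add]
    omega


/-- The first extreme positions, of both directions, of a suffix of the infinite power of a nice
word. -/
theorem NiceSeq.exists_extreme (hf : NiceSeq r f a p) (s : ℕ) :
    ∃ x y, Extreme r (fun n => f (s + n)) x ∧ Extreme (flip r) (fun n => f (s + n)) y ∧
      (x + p < a ∧ y = x + p ∨ y < p ∧ x = y + (a - p)) := by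
  have ha := hf.pos
  have hp := hf.p_pos
  have hpa := hf.two_mul_p_le
  have hlt := Nat.mod_lt s ha
  have hs := Nat.mod_add_div s a
  have hx : ∀ x, (s % a + x) % a = 0 → Extreme r (fun n => f (s + n)) x := fun x hx =>
    Extreme.shift (hf.top.congr_mod hf.toPrimPeriodic (by rw [Nat.zero_mod, ← hx, Nat.mod_add_mod]))
  have hy : ∀ y, (s % a + y) % a = p % a → Extreme (flip r) (fun n => f (s + n)) y := fun y hy =>
    Extreme.shift (hf.bot.congr_mod hf.toPrimPeriodic (by rw [← hy, Nat.mod_add_mod]))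
  rcases Nat.eq_zero_or_pos (s % a) with h0 | h0
  · exact ⟨0, p, hx _ (by simp [h0]), hy _ (by simp [h0]), by omega⟩
  · rcases le_or_gt (s % a) p with h1 | h1
    · refine ⟨a - s % a, p - s % a, hx _ ?_, hy _ ?_, by omega⟩
      · rw [Nat.add_sub_cancel' hlt.le, Nat.mod_self]
      · rw [Nat.add_sub_cancel' h1]
    · refine ⟨a - s % a, a + p - s % a, hx _ ?_, hy _ ?_, by omega⟩
      · rw [Nat.add_sub_cancel' hlt.le, Nat.mod_self]
      · rw [Nat.add_sub_cancel' (by omega), Nat.add_mod_left]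

/-- The overlap from a nice word to a shorter one that is extreme at `0` in the same direction. -/
theorem NiceSeq.overlap_same (hr : ∀ ⦃u v⦄, r u v → r v u → u = v) (hf : NiceSeq r f a p)
    (hh : NiceSeq r h b q) (hba : b ≤ a) {s : ℕ} (hag : ∀ n < e, f (s + n) = h n)
    (hne : f (s + e) ≠ h e) :
    e + p ≤ a + b ∨ (e + p < a + q + b ∧ p + 2 * b ≤ a + q ∧ q + b ≤ e) := by
  have hpa := hf.two_mul_p_le
  obtain ⟨x, y, hx, hy, ⟨h1, h2⟩ | ⟨h1, h2⟩⟩ := hf.exists_extreme s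
  · exact Or.inl (overlap_le_of_same_first hr hx hy hh hag hne h2 (by omega) (by omega))
  · have := overlap_le_of_opposite_first hr (hf.shift s) hx hy hh hag hne hba h2 (p := p) (by omega)
      (by omega) hpa (by omega)
    omega

/-- The overlap from a nice word to a shorter one that is extreme at `0` in the opposite
direction. -/
theorem NiceSeq.overlap_opposite (hr : ∀ ⦃u v⦄, r u v → r v u → u = v)
    (hf : NiceSeq (flip r) f a p)
    (hh : NiceSeq r h b q) (hba : b ≤ a) {s : ℕ} (hag : ∀ n < e, f (s + n) = h n)
    (hne : f (s + e) ≠ h e) :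
    e + p ≤ a + b ∨ (e + p < a + q + b ∧ p + 2 * b ≤ a + q ∧ 3 * b ≤ a) := by
  have hpa := hf.two_mul_p_le
  have hqb := hh.two_mul_p_le
  obtain ⟨y, x, hy, hx, ⟨h1, h2⟩ | ⟨h1, h2⟩⟩ := hf.exists_extreme s
  · have := overlap_le_of_opposite_first hr (hf.shift s) hx hy hh hag hne hba h2 (p := p) (by omega)
      (by omega) hpa (by omega)
    omega
  · exact Or.inl (overlap_le_of_same_first hr hx hy hh hag hne h2 (by omega) (by omega))

/-- If the infinite power of `f` contains an occurrence of `h` long enough to show both extreme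
rotations of `h`, then the extreme suffixes of `f` and `h` begin alike, which shortens the overlap
in the other direction. -/
theorem NiceSeq.reverse_overlap_le (hr : ∀ ⦃u v⦄, r u v → r v u → u = v) (hf : NiceSeq r f a p)
    (hh : NiceSeq r h b q) {s t : ℕ} (hs : ∀ n < q + b, f (s + n) = h n)
    (hag : ∀ n < e, h (t + n) = f n) (hne : h (t + e) ≠ f e) (hp : p < q + b) : e ≤ b + q := by
  by_contra! he
  have hr' : ∀ ⦃u v⦄, flip r u v → flip r v u → u = v := fun u v h1 h2 => hr h2 h1
  have hb := hh.toPrimPeriodic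
  have hq := hh.two_mul_p_le
  have hq0 := hh.p_pos
  have h1 : ∀ n, h (t + n) = h n := by
    have := hb.eq_of_block (i := t) (j := 0) <|
      hf.top.prefix_eq hr hh.top (c := s) (fun n hn => by rw [zero_add, hs n (by omega)])
        (fun n hn => by rw [zero_add, hag n (by omega)])
    simpa using this
  have hfh : ∀ n < e, f n = h n := fun n hn => by rw [← hag n hn, h1]
  have h2 : ∀ l, p + l ≤ e → l ≤ b → ∀ n < l, h (p + n) = h (q + n) := fun l hl hlb =>
    hf.bot.prefix_eq hr' hh.bot (c := s + q)
      (fun n hn => by rw [add_assoc, hs _ (by omega)]) (fun n hn => hfh _ (by omega))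
  rcases le_or_gt (p + b) e with hpb | hpb
  · have h3 := hb.mod_eq (h2 b hpb le_rfl)
    rw [Nat.mod_eq_of_lt (show q < b by omega)] at h3
    have h4 : p = q := by
      rcases lt_or_ge p b with h5 | h5
      · rwa [Nat.mod_eq_of_lt h5] at h3
      · rw [Nat.mod_eq_sub_mod h5, Nat.mod_eq_of_lt (by omega)] at h3
        omega
    have := hf.overlap_lt hr (hb.shift t) hag hne
    omega
  · obtain ⟨n, hn, hn'⟩ := hh.bot.unbordered hr' hb (t := p - q) (by omega) (by omega)
    apply hn'
    rw [show q + (p - q) + n = p + n by omega]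
    exact h2 (e - p) (by omega) (by omega) n (by omega)

end Sequences

/-- `f` behaves like the infinite power of a nice word of length `a` whose second extreme rotation
starts at position `p`; the word is either a maximal or a minimal rotation. -/
def IsNiceSeq {α : Type*} [LinearOrder α] (f : ℕ → α) (a p : ℕ) : Prop :=
  NiceSeq (· ≤ ·) f a p ∨ NiceSeq (· ≥ ·) f a p

/-- Some suffix of `f` and the sequence `h` have a common prefix of length `e`, but no suffix of
`f` is equal to `h`. -/
def SeqOverlap {α : Type*} (f h : ℕ → α) (e : ℕ) : Prop :=
  (∃ s, ∀ n < e, f (s + n) = h n) ∧ ∀ s, ∃ n, f (s + n) ≠ h n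

/-! ### Bounds on the overlaps of nice words -/

section Overlap

variable {α : Type*} [LinearOrder α] {f h : ℕ → α} {a b e e' p q : ℕ}

theorem SeqOverlap.exists_maximal (H : SeqOverlap f h e) :
    ∃ s e', e ≤ e' ∧ (∀ n < e', f (s + n) = h n) ∧ f (s + e') ≠ h e' := by
  obtain ⟨⟨s, hs⟩, H⟩ := H
  refine ⟨s, Nat.find (H s), ?_, fun l hl => not_not.1 (Nat.find_min (H s) hl), Nat.find_spec (H s)⟩
  by_contra! hlt
  exact Nat.find_spec (H s) (hs _ hlt)

theorem IsNiceSeq.primPeriodic (hf : IsNiceSeq f a p) : PrimPeriodic f a :=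
  hf.elim (·.toPrimPeriodic) (·.toPrimPeriodic)

theorem IsNiceSeq.two_mul_p_le (hf : IsNiceSeq f a p) : 2 * p ≤ a :=
  hf.elim (·.two_mul_p_le) (·.two_mul_p_le)

theorem le_antisymm_ge : ∀ ⦃u v : α⦄, u ≥ v → v ≥ u → u = v := fun _ _ h1 h2 => le_antisymm h2 h1

theorem SeqOverlap.lt_add (H : SeqOverlap f h e) (hf : IsNiceSeq f a p) (hh : IsNiceSeq h b q) :
    e < a + q := by
  obtain ⟨s, e', he, hag, hne⟩ := H.exists_maximal
  rcases hh with hh | hh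
  · exact he.trans_lt (hh.overlap_lt (fun _ _ => le_antisymm) (hf.primPeriodic.shift s) hag hne)
  · exact he.trans_lt (hh.overlap_lt le_antisymm_ge (hf.primPeriodic.shift s) hag hne)

theorem SeqOverlap.lt_of_le (H : SeqOverlap f h e) (hf : IsNiceSeq f a p) (hh : IsNiceSeq h b q)
    (hab : a ≤ b) : e < b := by
  obtain ⟨s, e', he, hag, hne⟩ := H.exists_maximal
  rcases hh with hh | hh
  · exact he.trans_lt
      (hh.overlap_lt_of_le (fun _ _ => le_antisymm) (hf.primPeriodic.shift s) hag hne hab)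
  · exact he.trans_lt
      (hh.overlap_lt_of_le le_antisymm_ge (hf.primPeriodic.shift s) hag hne hab)

/-- The bounds on the overlap from a nice word to a shorter one. -/
theorem SeqOverlap.le_or (H : SeqOverlap f h e) (hf : IsNiceSeq f a p) (hh : IsNiceSeq h b q)
    (hba : b ≤ a) : e + p ≤ a + b ∨ (e + p ≤ a + q + b ∧ p + 2 * b ≤ a + q) := by
  obtain ⟨s, e', he, hag, hne⟩ := H.exists_maximal
  rcases hf with hf | hf <;> rcases hh with hh | hh
  · have := hf.overlap_same (fun _ _ => le_antisymm) hh hba hag hne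
    omega
  · have := NiceSeq.overlap_opposite le_antisymm_ge hf hh hba hag hne
    omega
  · have := NiceSeq.overlap_opposite (fun _ _ => le_antisymm) hf hh hba hag hne
    omega
  · have := hf.overlap_same le_antisymm_ge hh hba hag hne
    omega

/-- A supplement to `SeqOverlap.le_or`, on the overlaps in both directions. -/
theorem SeqOverlap.le_or_of_symm (H : SeqOverlap f h e) (H' : SeqOverlap h f e')
    (hf : IsNiceSeq f a p) (hh : IsNiceSeq h b q) (hba : b ≤ a) :
    e + p ≤ a + b ∨ 3 * b ≤ a ∨ e' ≤ b + q := by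
  obtain ⟨s, m, he, hag, hne⟩ := H.exists_maximal
  obtain ⟨t, m', he', hag', hne'⟩ := H'.exists_maximal
  rcases hf with hf | hf <;> rcases hh with hh | hh
  · have h1 := hf.overlap_same (fun _ _ => le_antisymm) hh hba hag hne
    by_contra! hcon
    have := hf.reverse_overlap_le (fun _ _ => le_antisymm) hh (fun n hn => hag n (by omega))
      hag' hne' (by omega)
    omega
  · have := NiceSeq.overlap_opposite le_antisymm_ge hf hh hba hag hne
    omega
  · have := NiceSeq.overlap_opposite (fun _ _ => le_antisymm) hf hh hba hag hne
    omega
  · have h1 := hf.overlap_same le_antisymm_ge hh hba hag hne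
    by_contra! hcon
    have := hf.reverse_overlap_le le_antisymm_ge hh (fun n hn => hag n (by omega))
      hag' hne' (by omega)
    omega

end Overlap


/-! ### The numerical inequality for a cycle -/

/-- The bounds for an edge of weight `e` from a node with word length `a` to a node with word
length `b`; here `p` and `q` are the positions of the second extreme rotations of the two words. -/
structure EdgeBound (a p b q e : ℤ) : Prop where
  two_mul_p_le : 2 * p ≤ a
  le_add : e ≤ a + q
  cases : (a ≤ b ∧ e ≤ b) ∨ (b < a ∧ e + p ≤ a + b) ∨
    (b < a ∧ e + p ≤ a + q + b ∧ p + 2 * b ≤ a + q)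

section CycleBounds

variable {a₀ a₁ a₂ a₃ a₄ p₀ p₁ p₂ p₃ p₄ e₀ e₁ e₂ e₃ e₄ M : ℤ}

theorem cycle_bound_two (h₀ : EdgeBound a₀ p₀ a₁ p₁ e₀) (h₁ : EdgeBound a₁ p₁ a₀ p₀ e₁)
    (H₀ : a₁ ≤ a₀ → e₀ + p₀ ≤ a₀ + a₁ ∨ 3 * a₁ ≤ a₀ ∨ e₁ ≤ a₁ + p₁)
    (H₁ : a₀ ≤ a₁ → e₁ + p₁ ≤ a₁ + a₀ ∨ 3 * a₀ ≤ a₁ ∨ e₀ ≤ a₀ + p₀)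
    (hM₀ : M ≤ e₀) (hM₁ : M ≤ e₁) : 2 * M + 7 * (e₀ + e₁) ≤ 11 * (a₀ + a₁) := by
  obtain ⟨_, _, h₀⟩ := h₀
  obtain ⟨_, _, h₁⟩ := h₁
  rcases le_total a₁ a₀ with h | h
  · rcases H₀ h with H | H | H <;> rcases h₀ with h₀ | h₀ | h₀ <;> rcases h₁ with h₁ | h₁ | h₁ <;>
      linarith
  · rcases H₁ h with H | H | H <;> rcases h₀ with h₀ | h₀ | h₀ <;> rcases h₁ with h₁ | h₁ | h₁ <;>
      linarith

theorem cycle_bound_three (h₀ : EdgeBound a₀ p₀ a₁ p₁ e₀) (h₁ : EdgeBound a₁ p₁ a₂ p₂ e₁)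
    (h₂ : EdgeBound a₂ p₂ a₀ p₀ e₂) (hM₀ : M ≤ e₀) (hM₁ : M ≤ e₁) (hM₂ : M ≤ e₂) :
    2 * M + 7 * (e₀ + e₁ + e₂) ≤ 11 * (a₀ + a₁ + a₂) := by
  obtain ⟨_, _, h₀⟩ := h₀
  obtain ⟨_, _, h₁⟩ := h₁
  obtain ⟨_, _, h₂⟩ := h₂
  rcases h₀ with h₀ | h₀ | h₀ <;> rcases h₁ with h₁ | h₁ | h₁ <;> rcases h₂ with h₂ | h₂ | h₂ <;>
    linarith

set_option maxHeartbeats 2000000 in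
-- There is one linear programme for each of the `3 ^ 4` combinations of cases.
theorem cycle_bound_four (h₀ : EdgeBound a₀ p₀ a₁ p₁ e₀) (h₁ : EdgeBound a₁ p₁ a₂ p₂ e₁)
    (h₂ : EdgeBound a₂ p₂ a₃ p₃ e₂) (h₃ : EdgeBound a₃ p₃ a₀ p₀ e₃)
    (hM₀ : M ≤ e₀) (hM₁ : M ≤ e₁) (hM₂ : M ≤ e₂) (hM₃ : M ≤ e₃) :
    2 * M + 7 * (e₀ + e₁ + e₂ + e₃) ≤ 11 * (a₀ + a₁ + a₂ + a₃) := by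
  obtain ⟨_, _, h₀⟩ := h₀
  obtain ⟨_, _, h₁⟩ := h₁
  obtain ⟨_, _, h₂⟩ := h₂
  obtain ⟨_, _, h₃⟩ := h₃
  rcases h₀ with h₀ | h₀ | h₀ <;> rcases h₁ with h₁ | h₁ | h₁ <;> rcases h₂ with h₂ | h₂ | h₂ <;>
    rcases h₃ with h₃ | h₃ | h₃ <;> linarith

set_option maxHeartbeats 10000000 in
-- There is one linear programme for each of the `3 ^ 5` combinations of cases.
theorem cycle_bound_five (h₀ : EdgeBound a₀ p₀ a₁ p₁ e₀) (h₁ : EdgeBound a₁ p₁ a₂ p₂ e₁)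
    (h₂ : EdgeBound a₂ p₂ a₃ p₃ e₂) (h₃ : EdgeBound a₃ p₃ a₄ p₄ e₃) (h₄ : EdgeBound a₄ p₄ a₀ p₀ e₄)
    (hM₀ : M ≤ e₀) (hM₁ : M ≤ e₁) (hM₂ : M ≤ e₂) (hM₃ : M ≤ e₃) (hM₄ : M ≤ e₄) :
    2 * M + 7 * (e₀ + e₁ + e₂ + e₃ + e₄) ≤ 11 * (a₀ + a₁ + a₂ + a₃ + a₄) := by
  obtain ⟨_, _, h₀⟩ := h₀
  obtain ⟨_, _, h₁⟩ := h₁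
  obtain ⟨_, _, h₂⟩ := h₂
  obtain ⟨_, _, h₃⟩ := h₃
  obtain ⟨_, _, h₄⟩ := h₄
  rcases h₀ with h₀ | h₀ | h₀ <;> rcases h₁ with h₁ | h₁ | h₁ <;> rcases h₂ with h₂ | h₂ | h₂ <;>
    rcases h₃ with h₃ | h₃ | h₃ <;> rcases h₄ with h₄ | h₄ | h₄ <;> linarith

/-- The contribution of a single edge to the bound for long cycles: three times the slack
`(4 * a - 7 * p) + (4 * b - 7 * q) + 7 * (a + q - e)` of the edge and its ends is at least
`2 * M`. -/
theorem EdgeBound.two_mul_le {a p b q e : ℤ} (h : EdgeBound a p b q e) (hq : 2 * q ≤ b)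
    (hM : M ≤ e) : 2 * M ≤ 33 * a + 12 * b - 21 * p - 21 * e := by
  obtain ⟨_, _, h⟩ := h
  rcases h with h | h | h <;> linarith

end CycleBounds

/-- The hypothesis `hE'` is of use for cycles with two nodes only. -/
theorem cycle_bound {k : ℕ} (hk : 2 ≤ k) {a p e : Fin k → ℤ} {M : ℤ} (hM0 : 0 ≤ M)
    (hE : ∀ i, EdgeBound (a i) (p i) (a (finRotate k i)) (p (finRotate k i)) (e i))
    (hE' : ∀ i, finRotate k (finRotate k i) = i → a (finRotate k i) ≤ a i →
      e i + p i ≤ a i + a (finRotate k i) ∨ 3 * a (finRotate k i) ≤ a i ∨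
        e (finRotate k i) ≤ a (finRotate k i) + p (finRotate k i))
    (hM : ∀ i, M ≤ e i) : 2 * M + 7 * ∑ i, e i ≤ 11 * ∑ i, a i := by
  rcases Nat.lt_or_ge k 6 with hk6 | hk6
  · interval_cases k
    · rw [Fin.sum_univ_two, Fin.sum_univ_two]
      exact cycle_bound_two (hE 0) (hE 1) (hE' 0 rfl) (hE' 1 rfl) (hM 0) (hM 1)
    · rw [Fin.sum_univ_three, Fin.sum_univ_three]
      exact cycle_bound_three (hE 0) (hE 1) (hE 2) (hM 0) (hM 1) (hM 2)
    · rw [Fin.sum_univ_four, Fin.sum_univ_four]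
      exact cycle_bound_four (hE 0) (hE 1) (hE 2) (hE 3) (hM 0) (hM 1) (hM 2) (hM 3)
    · rw [Fin.sum_univ_five, Fin.sum_univ_five]
      exact cycle_bound_five (hE 0) (hE 1) (hE 2) (hE 3) (hE 4) (hM 0) (hM 1) (hM 2) (hM 3) (hM 4)
  · have h1 : ∑ _i : Fin k, 2 * M ≤ ∑ i, (33 * a i + 12 * a (finRotate k i) - 21 * p i - 21 * e i) :=
      Finset.sum_le_sum fun i _ => (hE i).two_mul_le (hE _).two_mul_p_le (hM i)
    have h2 : ∑ i, e i ≤ ∑ i, (a i + p (finRotate k i)) :=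
      Finset.sum_le_sum fun i _ => (hE i).le_add
    have h3 : (6 : ℤ) * M ≤ k * M := mul_le_mul_of_nonneg_right (by exact_mod_cast hk6) hM0
    simp only [Finset.sum_sub_distrib, Finset.sum_add_distrib, ← Finset.mul_sum,
      Finset.sum_const, Finset.card_univ, Fintype.card_fin, nsmul_eq_mul,
      Equiv.sum_comp (finRotate k) a, Equiv.sum_comp (finRotate k) p] at h1 h2
    linarith


/-! ### Infinite powers of strings -/

section Lists

variable {α : Type*} {u v w x : List α}

/-- The infinite power `www⋯` of a nonempty string, as a sequence of letters. -/
def powSeq (w : List α) (hw : 0 < w.length) (n : ℕ) : α :=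
  w[n % w.length]'(Nat.mod_lt n hw)

theorem powSeq_of_lt (hw : 0 < w.length) {n : ℕ} (hn : n < w.length) : powSeq w hw n = w[n] := by
  simp [powSeq, Nat.mod_eq_of_lt hn]

theorem powSeq_add_length (hw : 0 < w.length) (n : ℕ) :
    powSeq w hw (n + w.length) = powSeq w hw n := by
  simp [powSeq]

theorem powSeq_mod (hw : 0 < w.length) (n : ℕ) :
    powSeq w hw (n % w.length) = powSeq w hw n := by
  simp [powSeq]

theorem length_strPow (w : List α) (k : ℕ) : (strPow w k).length = k * w.length := by
  simp [strPow]

theorem getElem?_strPow (hw : 0 < w.length) {k n : ℕ} (hn : n < k * w.length) :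
    (strPow w k)[n]? = some (powSeq w hw n) := by
  induction k generalizing n with
  | zero => simp at hn
  | succ k ih =>
    have h1 : strPow w (k + 1) = w ++ strPow w k := by simp [strPow, List.replicate_succ]
    rw [h1]
    rcases lt_or_ge n w.length with h | h
    · rw [List.getElem?_append_left h, powSeq_of_lt hw h, List.getElem?_eq_getElem h]
    · obtain ⟨m, rfl⟩ := Nat.exists_eq_add_of_le' h
      rw [List.getElem?_append_right h, Nat.add_sub_cancel, powSeq_add_length]
      exact ih (by rw [Nat.succ_mul] at hn; omega)

theorem IsWString.getElem_eq (h : IsWString w x) (hw : 0 < w.length) {n : ℕ} (hn : n < x.length) :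
    x[n] = powSeq w hw n := by
  obtain ⟨k, t, ht⟩ := h
  have h2 : n < k * w.length := by
    rw [← length_strPow, ← ht, List.length_append]
    omega
  have h1 := getElem?_strPow hw h2
  rw [← ht, List.getElem?_append_left hn, List.getElem?_eq_getElem hn] at h1
  simpa using h1

theorem isWString_of_getElem_eq (hw : 0 < w.length)
    (h : ∀ n (hn : n < x.length), x[n] = powSeq w hw n) : IsWString w x := by
  refine ⟨x.length, ?_⟩
  have hlen : x.length ≤ x.length * w.length := Nat.le_mul_of_pos_right _ hw
  rw [List.prefix_iff_eq_take]
  refine List.ext_getElem? fun n => ?_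
  rcases lt_or_ge n x.length with hn | hn
  · rw [List.getElem?_take_of_lt hn, getElem?_strPow hw (by omega), List.getElem?_eq_getElem hn,
      h n hn]
  · rw [List.getElem?_eq_none hn, List.getElem?_eq_none]
    simp [hn]

theorem primPeriodic_powSeq (hw : 0 < w.length) (hp : IsPrimitive w) :
    PrimPeriodic (powSeq w hw) w.length where
  pos := hw
  add_period := powSeq_add_length hw
  dvd d hd := by
    -- The set of periods is closed under greatest common divisors.
    have hg : ∀ c d : ℕ, (∀ n, powSeq w hw (n + c) = powSeq w hw n) →
        (∀ n, powSeq w hw (n + d) = powSeq w hw n) →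
        ∀ n, powSeq w hw (n + Nat.gcd c d) = powSeq w hw n := by
      intro c d
      induction c, d using Nat.gcd.induction with
      | H0 d => intro _ h; simpa using h
      | H1 c d hc ih =>
        intro h1 h2
        rw [Nat.gcd_rec]
        refine ih (fun n => ?_) h1
        rw [← add_mul_of_period h1 (n + d % c) (d / c), add_assoc, Nat.mod_add_div, h2]
    have h1 := hg _ _ hd (powSeq_add_length hw)
    have h2 := Nat.gcd_dvd_right d w.length
    set c := Nat.gcd d w.length with hc
    obtain ⟨k, hk⟩ := h2
    have hc0 : 0 < c := Nat.gcd_pos_of_pos_right _ hw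
    have hcle : c ≤ w.length := Nat.gcd_le_right _ hw
    by_cases hk2 : 2 ≤ k
    · exfalso
      have hv : 0 < (w.take c).length := by simp; omega
      refine hp (w.take c) k hk2 (List.ext_getElem? fun n => ?_)
      have hl : (w.take c).length = c := by simp [hcle]
      rcases lt_or_ge n w.length with hn | hn
      · rw [getElem?_strPow hv (by rw [hl, mul_comm, ← hk]; exact hn), List.getElem?_eq_getElem hn,
          ← powSeq_of_lt hw hn]
        rw [← Nat.mod_add_div n c, add_mul_of_period h1]
        have h3 := Nat.mod_lt n hc0
        rw [powSeq_of_lt hw (by omega)]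
        simp [powSeq, hl]
      · rw [List.getElem?_eq_none hn, List.getElem?_eq_none]
        rw [length_strPow, hl, mul_comm, ← hk]
        exact hn
    · have : k = 1 := by
        rcases Nat.eq_zero_or_pos k with rfl | h0
        · omega
        · omega
      rw [hk, this, mul_one]
      exact Nat.gcd_dvd_left _ _

theorem getElem_rotate_eq (hw : 0 < w.length) (j : ℕ) {n : ℕ} (hn : n < (w.rotate j).length) :
    (w.rotate j)[n] = powSeq w hw (j + n) := by
  rw [List.getElem_rotate]
  simp [powSeq, add_comm]

theorem equivalent_of_powSeq_eq (hu : 0 < u.length) (hv : 0 < v.length)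
    (hu' : PrimPeriodic (powSeq u hu) u.length) (hv' : PrimPeriodic (powSeq v hv) v.length)
    {s : ℕ} (H : ∀ n, powSeq u hu (s + n) = powSeq v hv n) : Equivalent u v := by
  have h1 : v.length ∣ u.length := hv'.dvd _ fun n => by
    rw [← H, ← H, ← add_assoc, powSeq_add_length]
  have h2 : u.length ∣ v.length := (hu'.shift s).dvd _ fun n => by
    simp only [H, powSeq_add_length]
  have h3 := Nat.dvd_antisymm h1 h2
  refine ⟨s, List.ext_getElem (by simp [h3]) fun n h4 h5 => ?_⟩
  rw [getElem_rotate_eq hu, H, powSeq_of_lt hv h5]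

end Lists

/-! ### Nice strings -/

section Nice

variable {α : Type*} [LinearOrder α] {w : List α}

theorem rotate_lt_rotate_iff (hw : 0 < w.length) {i j : ℕ} :
    w.rotate i < w.rotate j ↔ ∃ m, (∀ n < m, powSeq w hw (i + n) = powSeq w hw (j + n)) ∧
      powSeq w hw (i + m) < powSeq w hw (j + m) := by
  rw [List.lt_iff_exists]
  constructor
  · rintro (⟨_, h⟩ | ⟨m, h1, h2, h3, h4⟩)
    · simp at h
    · refine ⟨m, fun n hn => ?_, ?_⟩
      · have := h3 n hn
        rwa [getElem_rotate_eq hw, getElem_rotate_eq hw] at this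
      · rwa [getElem_rotate_eq hw, getElem_rotate_eq hw] at h4
  · rintro ⟨m, h1, h2⟩
    have hm : m < w.length := by
      by_contra! hm
      have hmod : ∀ l, powSeq w hw (l + m) = powSeq w hw (l + m % w.length) := fun l => by
        rw [← powSeq_mod, ← powSeq_mod hw (l + m % w.length), Nat.add_mod_mod]
      rw [hmod, hmod, h1 _ ((Nat.mod_lt m hw).trans_le hm)] at h2
      exact lt_irrefl _ h2
    refine Or.inr ⟨m, by simpa using hm, by simpa using hm, fun n hn => ?_, ?_⟩
    · rw [getElem_rotate_eq hw, getElem_rotate_eq hw, h1 n hn]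
    · rwa [getElem_rotate_eq hw, getElem_rotate_eq hw]

theorem isMaxRotation_rotate_iff (hw : 0 < w.length) {i : ℕ} :
    IsMaxRotation w (w.rotate i) ↔ Extreme (· ≤ ·) (powSeq w hw) i := by
  constructor
  · rintro ⟨_, h⟩ j m hm
    by_contra! hlt
    exact (not_lt.2 (h _ ⟨j, rfl⟩))
      ((rotate_lt_rotate_iff hw).2 ⟨m, fun n hn => (hm n hn).symm, hlt⟩)
  · refine fun h => ⟨⟨i, rfl⟩, ?_⟩
    rintro _ ⟨j, rfl⟩
    by_contra! hlt
    obtain ⟨m, h1, h2⟩ := (rotate_lt_rotate_iff hw).1 hlt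
    exact not_lt.2 (h j m fun n hn => (h1 n hn).symm) h2

theorem isMinRotation_rotate_iff (hw : 0 < w.length) {i : ℕ} :
    IsMinRotation w (w.rotate i) ↔ Extreme (· ≥ ·) (powSeq w hw) i := by
  constructor
  · rintro ⟨_, h⟩ j m hm
    by_contra! hlt
    exact (not_lt.2 (h _ ⟨j, rfl⟩)) ((rotate_lt_rotate_iff hw).2 ⟨m, hm, hlt⟩)
  · refine fun h => ⟨⟨i, rfl⟩, ?_⟩
    rintro _ ⟨j, rfl⟩
    by_contra! hlt
    obtain ⟨m, h1, h2⟩ := (rotate_lt_rotate_iff hw).1 hlt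
    exact not_lt.2 (h j m h1) h2

theorem IsNice.exists_isNiceSeq (h : IsNice w) (hw : 0 < w.length) :
    ∃ p, IsNiceSeq (powSeq w hw) w.length p := by
  obtain ⟨h2, hprim, pmin, pmax, hmin, hmax, hif⟩ := h
  have hP := primPeriodic_powSeq hw hprim
  have hne : ∀ i, Extreme (· ≤ ·) (powSeq w hw) i → ¬ Extreme (· ≥ ·) (powSeq w hw) i := by
    intro i h1 h3
    have h4 : ∀ n, powSeq w hw (i + 1 + n) = powSeq w hw (i + n) := by
      intro n
      induction n using Nat.strong_induction_on with
      | _ n ih => exact le_antisymm (h1 (i + 1) n ih) (h3 (i + 1) n ih)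
    have h5 := (hP.shift i).dvd 1 fun n => by rw [← h4 n]; congr 1; omega
    have := Nat.le_of_dvd one_pos h5
    omega
  have h0 : w.rotate 0 = w := List.rotate_zero w
  have hlen : w.length = pmin.length + pmax.length := by
    simpa using hmin.1.perm.length_eq
  split_ifs at hif with hle
  · have hr : w.rotate pmax.length = pmin ++ pmax := by
      rw [hif, List.rotate_append_length_eq]
    rw [← hif] at hmax
    rw [← hr, isMinRotation_rotate_iff hw] at hmin
    have hmax0 : Extreme (· ≤ ·) (powSeq w hw) 0 :=
      (isMaxRotation_rotate_iff hw).1 (by rw [h0]; exact hmax)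
    refine ⟨pmax.length, Or.inl ⟨hP, hmax0, hmin, ?_, by omega⟩⟩
    rcases Nat.eq_zero_or_pos pmax.length with h | h
    · rw [h] at hmin
      exact absurd hmin (hne 0 hmax0)
    · exact h
  · have hr : w.rotate pmin.length = pmax ++ pmin := by
      rw [hif, List.rotate_append_length_eq]
    rw [← hif] at hmin
    rw [← hr, isMaxRotation_rotate_iff hw] at hmax
    have hmin0 : Extreme (· ≥ ·) (powSeq w hw) 0 :=
      (isMinRotation_rotate_iff hw).1 (by rw [h0]; exact hmin)
    refine ⟨pmin.length, Or.inr ⟨hP, hmin0, hmax, ?_, by omega⟩⟩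
    rcases Nat.eq_zero_or_pos pmin.length with h | h
    · rw [h] at hmax
      exact absurd hmin0 (hne 0 hmax)
    · exact h

end Nice


/-! ### Overlaps and periods of strings -/

section Overlap

variable {α : Type*}

theorem take_overlap_isSuffix [DecidableEq α] (u v : List α) :
    v.take (overlapWeight u v) <:+ u ∧ overlapWeight u v ≤ v.length := by
  have h1 := Nat.findGreatest_spec (P := fun n => v.take n <:+ u) (Nat.zero_le v.length)
    (by simp)
  have h2 := Nat.findGreatest_le (P := fun n => v.take n <:+ u) v.length
  simp only [overlapWeight, overlap, List.length_take, Nat.min_eq_left h2]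
  exact ⟨h1, h2⟩

theorem le_overlapWeight [DecidableEq α] {u v : List α} {n : ℕ} (hn : n ≤ v.length)
    (h : v.take n <:+ u) : n ≤ overlapWeight u v := by
  have h2 := Nat.findGreatest_le (P := fun n => v.take n <:+ u) v.length
  simp only [overlapWeight, overlap, List.length_take, Nat.min_eq_left h2]
  exact Nat.le_findGreatest hn h

variable [LinearOrder α] {u v x y : List α}

theorem seqOverlap_overlapWeight (hu : 0 < u.length) (hv : 0 < v.length)
    (hu' : PrimPeriodic (powSeq u hu) u.length) (hv' : PrimPeriodic (powSeq v hv) v.length)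
    (hx : IsWString u x) (hy : IsWString v y) (hne : ¬ Equivalent u v) :
    SeqOverlap (powSeq u hu) (powSeq v hv) (overlapWeight x y) := by
  refine ⟨?_, fun s => ?_⟩
  · obtain ⟨⟨t, ht⟩, hle⟩ := take_overlap_isSuffix x y
    have hlen : x.length = t.length + overlapWeight x y := by
      conv_lhs => rw [← ht]
      simp [hle]
    refine ⟨t.length, fun n hn => ?_⟩
    rw [← hx.getElem_eq hu (by omega), ← hy.getElem_eq hv (by omega),
      List.getElem_of_eq ht.symm, List.getElem_append_right (by omega)]
    simp
  · by_contra! H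
    exact hne (equivalent_of_powSeq_eq hu hv hu' hv' H)

theorem SeqOverlap.edgeBound {f h : ℕ → α} {a b p q e : ℕ} (H : SeqOverlap f h e)
    (hf : IsNiceSeq f a p) (hh : IsNiceSeq h b q) : EdgeBound a p b q e := by
  have h1 := H.lt_add hf hh
  have h2 := hf.two_mul_p_le
  refine ⟨by omega, by omega, ?_⟩
  rcases le_or_gt a b with hab | hab
  · have := H.lt_of_le hf hh hab
    omega
  · have := H.le_or hf hh hab.le
    omega

/-- The length of a nice word `w` is the least period of every `w`-string of at least that length,
since `w` is unbordered. -/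
theorem period_eq {w : List α} (hw : IsNice w) (hx : IsWString w x) (hle : w.length ≤ x.length) :
    period x = w.length := by
  have hw0 : 0 < w.length := by have := hw.1; omega
  have hget : ∀ n, n < x.length → x[n]? = some (powSeq w hw0 n) := fun n hn => by
    rw [List.getElem?_eq_getElem hn, hx.getElem_eq hw0 hn]
  have hper : IsPeriod x w.length := ⟨hw0, hle, List.hasPeriod_iff_getElem?.2 fun i hi => by
    rw [hget _ (by omega), hget _ (by omega), powSeq_add_length]⟩
  refine le_antisymm (Nat.sInf_le hper) (le_csInf ⟨_, hper⟩ ?_)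
  rintro d ⟨hd0, -, hd⟩
  by_contra! hlt
  obtain ⟨p, hp⟩ := hw.exists_isNiceSeq hw0
  have hborder : ∃ n < w.length - d, powSeq w hw0 (0 + d + n) ≠ powSeq w hw0 (0 + n) := by
    rcases hp with hp | hp
    · exact hp.top.unbordered (fun _ _ => le_antisymm) hp.toPrimPeriodic hd0 hlt
    · exact hp.top.unbordered le_antisymm_ge hp.toPrimPeriodic hd0 hlt
  obtain ⟨n, hn, hne⟩ := hborder
  have h1 := List.hasPeriod_iff_getElem?.1 hd n (by omega)
  rw [hget _ (by omega), hget _ (by omega), Option.some_inj] at h1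
  rw [zero_add, zero_add, add_comm d n] at hne
  exact hne h1.symm

end Overlap

theorem bound_of_isNiceFamily {α ι : Type*} [LinearOrder α] {w x : ι → List α}
    (H : IsNiceFamily w x) {k : ℕ} {c : Fin k → ι} (hk : 2 ≤ k) (hc : Function.Injective c) :
    2 * minOverlap (x ∘ c) + 7 * totalOverlap (x ∘ c) ≤ 11 * ∑ i, (w (c i)).length := by
  have hpos : ∀ i, 0 < (w i).length := fun i => by have := (H.nice i).1; omega
  choose p hp using fun i => (H.nice i).exists_isNiceSeq (hpos i)
  have hrot : ∀ i, c i ≠ c (finRotate k i) := fun i h => by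
    have h1 := congrArg Fin.val (hc h)
    obtain ⟨k, rfl⟩ := Nat.exists_eq_add_of_le' hk
    rw [coe_finRotate] at h1
    split_ifs at h1 with h2
    · subst h2; simp at h1
    · omega
  have hov : ∀ i j, i ≠ j → SeqOverlap (powSeq (w i) (hpos i)) (powSeq (w j) (hpos j))
      (overlapWeight (x i) (x j)) := fun i j hij =>
    seqOverlap_overlapWeight _ _ (hp i).primPeriodic (hp j).primPeriodic (H.wstring i)
      (H.wstring j) (H.nonequiv i j hij)
  have key := cycle_bound hk (a := fun i => (w (c i)).length) (p := fun i => p (c i))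
    (e := fun i => overlapWeight (x (c i)) (x (c (finRotate k i))))
    (M := minOverlap (x ∘ c)) (by positivity)
    (fun i => (hov _ _ (hrot i)).edgeBound (hp _) (hp _))
    (fun i hi hle => by
      have h1 := (hov _ _ (hrot i)).le_or_of_symm (hov _ _ (hrot i).symm) (hp _) (hp _)
        (by exact_mod_cast hle)
      rw [hi]
      omega)
    (fun i => by
      have : minOverlap (x ∘ c) ≤ overlapWeight (x (c i)) (x (c (finRotate k i))) :=
        ciInf_le (OrderBot.bddBelow _) i
      exact_mod_cast this)
  unfold totalOverlap
  simp only [Function.comp_apply]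
  exact_mod_cast key


/-! ### Cycles that attain the bound -/

section Tight

variable {α : Type*}

/-- The word of length `a` with the letter `o` at the positions in `S` and the letter `z`
elsewhere. -/
def binWord (z o : α) (S : Finset ℕ) (a : ℕ) : List α :=
  (List.range a).map fun n => if n ∈ S then o else z

/-- The position `n` of the infinite power of a word of length `a` lies in `S` modulo `a`; this
holds for the first three periods only, which are all that is used. -/
def OnePos (S : Finset ℕ) (a n : ℕ) : Prop :=
  n ∈ S ∨ a ≤ n ∧ n - a ∈ S ∨ 2 * a ≤ n ∧ n - 2 * a ∈ S

/-- The prefix of length `l` of the infinite power of `w`. -/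
def powPrefix (w : List α) (hw : 0 < w.length) (l : ℕ) : List α :=
  (List.range l).map (powSeq w hw)

variable {z o : α} {S T : Finset ℕ} {a b n p : ℕ}

theorem length_binWord : (binWord z o S a).length = a := by simp [binWord]

theorem powSeq_binWord (ha : 0 < (binWord z o S a).length) (hS : ∀ n ∈ S, n < a) (hn : n < 3 * a) :
    powSeq (binWord z o S a) ha n = o ∧ OnePos S a n ∨
      powSeq (binWord z o S a) ha n = z ∧ ¬ OnePos S a n := by
  have h1 : OnePos S a n ↔ n % a ∈ S := by
    unfold OnePos
    rcases lt_or_ge n a with h | h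
    · rw [Nat.mod_eq_of_lt h]
      refine ⟨?_, Or.inl⟩
      rintro (h1 | h1 | h1) <;> [exact h1; omega; omega]
    · rw [Nat.mod_eq_sub_mod h]
      have h2 : n ∉ S := fun h1 => by have := hS n h1; omega
      rcases lt_or_ge (n - a) a with h' | h'
      · rw [Nat.mod_eq_of_lt h']
        refine ⟨?_, fun h3 => Or.inr (Or.inl ⟨h, h3⟩)⟩
        rintro (h1 | h1 | h1) <;> [exact absurd h1 h2; exact h1.2; omega]
      · have h3 : n - a ∉ S := fun h1 => by have := hS _ h1; omega
        rw [Nat.mod_eq_sub_mod h', Nat.mod_eq_of_lt (by omega), Nat.sub_sub, ← two_mul]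
        refine ⟨?_, fun h4 => Or.inr (Or.inr ⟨by omega, h4⟩)⟩
        rintro (h1 | h1 | h1) <;> [exact absurd h1 h2; exact absurd h1.2 h3; exact h1.2]
  rw [h1]
  by_cases h : n % a ∈ S <;> simp [powSeq, binWord, h]

theorem isWString_powPrefix {w : List α} (hw : 0 < w.length) (l : ℕ) :
    IsWString w (powPrefix w hw l) :=
  isWString_of_getElem_eq hw fun n hn => by simp [powPrefix]

theorem length_powPrefix {w : List α} (hw : 0 < w.length) (l : ℕ) :
    (powPrefix w hw l).length = l := by
  simp [powPrefix]

theorem le_overlapWeight_powPrefix [DecidableEq α] {u v : List α} (hu : 0 < u.length)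
    (hv : 0 < v.length) {s l e : ℕ} (k : ℕ) (he : e ≤ l)
    (h : ∀ n < e, powSeq u hu (s + n) = powSeq v hv n) :
    e ≤ overlapWeight (powPrefix u hu (s + e + u.length * k)) (powPrefix v hv l) := by
  have hmul : ∀ n, powSeq u hu (n + u.length * k) = powSeq u hu n := fun n => by
    rw [← powSeq_mod, Nat.add_mul_mod_self_left, powSeq_mod]
  refine le_overlapWeight (by rwa [length_powPrefix]) ?_
  refine ⟨powPrefix u hu (s + u.length * k), List.ext_getElem ?_ fun n h1 h2 => ?_⟩
  · simp [length_powPrefix, he]; omega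
  · rw [List.getElem_append]
    split_ifs with h3
    · simp [powPrefix]
    · rw [length_powPrefix] at h3 h2
      simp only [powPrefix, List.getElem_take, List.getElem_map, List.getElem_range,
        List.length_map, List.length_range]
      rw [← h _ (by omega), ← hmul]
      congr 1
      omega

theorem le_overlapWeight_binWord [DecidableEq α]
    (ha : 0 < (binWord z o S a).length) (hb : 0 < (binWord z o T b).length)
    (hS : ∀ n ∈ S, n < a) (hT : ∀ n ∈ T, n < b) {s l e : ℕ} (k : ℕ) (he : e ≤ l)
    (hsa : s + e ≤ 3 * a) (heb : e ≤ 3 * b) (h : ∀ n < e, OnePos S a (s + n) ↔ OnePos T b n) :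
    e ≤ overlapWeight (powPrefix (binWord z o S a) ha (s + e + a * k))
      (powPrefix (binWord z o T b) hb l) := by
  have := le_overlapWeight_powPrefix ha hb k he (s := s) fun n hn => by
    have h1 := powSeq_binWord ha hS (n := s + n) (by omega)
    have h2 := powSeq_binWord hb hT (n := n) (by omega)
    have h3 := h n hn
    rcases h1 with ⟨h1, h1'⟩ | ⟨h1, h1'⟩ <;> rcases h2 with ⟨h2, h2'⟩ | ⟨h2, h2'⟩
    · rw [h1, h2]
    · tauto
    · tauto
    · rw [h1, h2]
  rwa [length_binWord] at this

theorem isPrimitive_of_primPeriodic {w : List α} (hw : 0 < w.length)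
    (h : PrimPeriodic (powSeq w hw) w.length) : IsPrimitive w := by
  rintro v k hk rfl
  have hl := length_strPow v k
  have hv : 0 < v.length := Nat.pos_of_mul_pos_left (hl ▸ hw)
  have heq : ∀ n, powSeq (strPow v k) hw n = powSeq v hv n := fun n => by
    have h1 : n % (strPow v k).length < (strPow v k).length := Nat.mod_lt _ hw
    rw [powSeq, ← Option.some_inj, ← List.getElem?_eq_getElem,
      getElem?_strPow hv (by rwa [← hl]), ← powSeq_mod hv, hl, Nat.mod_mul_left_mod, powSeq_mod]
  have h1 := Nat.le_of_dvd hv (h.dvd v.length fun n => by rw [heq, heq, powSeq_add_length])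
  rw [hl] at h1
  nlinarith

/-- It suffices to compare an extreme suffix with the suffixes at the other positions of one
period, up to the first difference. -/
theorem extreme_of_forall_lt {r : α → α → Prop} (hr : ∀ u, r u u) {f : ℕ → α} {i : ℕ}
    (hf : ∀ n, f (n + a) = f n) (ha : 0 < a)
    (H : ∀ j < a, j ≠ i → ∃ n, f (j + n) ≠ f (i + n) ∧ ∀ l ≤ n, r (f (j + l)) (f (i + l))) :
    Extreme r f i := by
  have hmod : ∀ j n, f (j + n) = f (j % a + n) := fun j n => by
    conv_lhs => rw [← Nat.mod_add_div j a, add_right_comm, add_mul_of_period hf]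
  intro j m hm
  by_cases hj : j % a = i
  · rw [hmod, hj]
    exact hr _
  · obtain ⟨n, h1, h2⟩ := H (j % a) (Nat.mod_lt _ ha) hj
    rw [hmod]
    refine h2 m ?_
    by_contra! hlt
    exact h1 (by rw [← hmod, hm n hlt])

theorem primPeriodic_of_forall_lt {f : ℕ → α} (hf : ∀ n, f (n + a) = f n) (ha : 0 < a)
    (H : ∀ j < a, j ≠ 0 → ∃ n, f (j + n) ≠ f (0 + n)) : PrimPeriodic f a where
  pos := ha
  add_period := hf
  dvd d hd := by
    by_contra hdvd
    obtain ⟨n, hn⟩ := H (d % a) (Nat.mod_lt _ ha) fun h => hdvd (Nat.dvd_of_mod_eq_zero h)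
    apply hn
    rw [← add_mul_of_period hf _ (d / a), add_right_comm, Nat.mod_add_div, zero_add, add_comm, hd]

variable [LinearOrder α]

theorem isNice_of_niceSeq_le {w : List α} (hw : 0 < w.length) (h2 : 2 ≤ w.length)
    (h : NiceSeq (· ≤ ·) (powSeq w hw) w.length p) : IsNice w := by
  have hp := h.two_mul_p_le
  have hl : (w.take p).length = p := by rw [List.length_take]; omega
  have hr : w.drop p ++ w.take p = w.rotate p := (List.rotate_eq_drop_append_take (by omega)).symm
  refine ⟨h2, isPrimitive_of_primPeriodic hw h.toPrimPeriodic, w.drop p, w.take p, ?_, ?_, ?_⟩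
  · rw [hr]
    exact (isMinRotation_rotate_iff hw).2 h.bot
  · rw [List.take_append_drop, ← List.rotate_zero w]
    simpa using (isMaxRotation_rotate_iff hw).2 h.top
  · rw [if_pos (by rw [hl, List.length_drop]; omega), List.take_append_drop]

theorem isNice_of_niceSeq_ge {w : List α} (hw : 0 < w.length) (h2 : 2 ≤ w.length)
    (h : NiceSeq (· ≥ ·) (powSeq w hw) w.length p) (hp : 2 * p < w.length) : IsNice w := by
  have hl : (w.take p).length = p := by rw [List.length_take]; omega
  have hr : w.drop p ++ w.take p = w.rotate p := (List.rotate_eq_drop_append_take (by omega)).symm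
  refine ⟨h2, isPrimitive_of_primPeriodic hw h.toPrimPeriodic, w.take p, w.drop p, ?_, ?_, ?_⟩
  · rw [List.take_append_drop, ← List.rotate_zero w]
    simpa using (isMinRotation_rotate_iff hw).2 h.top
  · rw [hr]
    exact (isMaxRotation_rotate_iff hw).2 h.bot
  · rw [if_neg (by rw [hl, List.length_drop]; omega), List.take_append_drop]

/-- The suffix at `i` is larger than the others: at the first difference it has the letter `o`. -/
theorem binWord_max (ha : 0 < (binWord z o S a).length) {i : ℕ} (hi : i ≤ a) (hzo : z < o)
    (hS : ∀ n ∈ S, n < a)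
    (H : ∀ j < a, j ≠ i → ∃ n < a, OnePos S a (i + n) ∧ ¬ OnePos S a (j + n) ∧
      ∀ l < n, OnePos S a (j + l) → OnePos S a (i + l)) :
    ∀ j < a, j ≠ i → ∃ n, powSeq _ ha (j + n) ≠ powSeq _ ha (i + n) ∧
      ∀ l ≤ n, powSeq _ ha (j + l) ≤ powSeq _ ha (i + l) := by
  intro j hj hji
  obtain ⟨n, hn, h1, h2, h3⟩ := H j hj hji
  have hz := fun n => powSeq_binWord (z := z) (o := o) (n := n) ha hS
  refine ⟨n, ?_, fun l hl => ?_⟩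
  · rcases hz (j + n) (by omega) with h4 | h4 <;> rcases hz (i + n) (by omega) with h5 | h5
    · exact absurd h4.2 h2
    · exact absurd h4.2 h2
    · rw [h4.1, h5.1]; exact hzo.ne
    · exact absurd h1 h5.2
  · rcases hz (j + l) (by omega) with h4 | h4 <;> rcases hz (i + l) (by omega) with h5 | h5
    · rw [h4.1, h5.1]
    · exfalso
      rcases hl.lt_or_eq with hl | rfl
      · exact h5.2 (h3 l hl h4.2)
      · exact h2 h4.2
    · rw [h4.1, h5.1]; exact hzo.le
    · rw [h4.1, h5.1]

/-- The suffix at `i` is smaller than the others: at the first difference it has the letter `z`. -/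
theorem binWord_min (ha : 0 < (binWord z o S a).length) {i : ℕ} (hi : i ≤ a) (hzo : z < o)
    (hS : ∀ n ∈ S, n < a)
    (H : ∀ j < a, j ≠ i → ∃ n < a, OnePos S a (j + n) ∧ ¬ OnePos S a (i + n) ∧
      ∀ l < n, OnePos S a (i + l) → OnePos S a (j + l)) :
    ∀ j < a, j ≠ i → ∃ n, powSeq _ ha (j + n) ≠ powSeq _ ha (i + n) ∧
      ∀ l ≤ n, powSeq _ ha (j + l) ≥ powSeq _ ha (i + l) := by
  intro j hj hji
  obtain ⟨n, hn, h1, h2, h3⟩ := H j hj hji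
  have hz := fun n => powSeq_binWord (z := z) (o := o) (n := n) ha hS
  refine ⟨n, ?_, fun l hl => ?_⟩
  · rcases hz (i + n) (by omega) with h4 | h4 <;> rcases hz (j + n) (by omega) with h5 | h5
    · exact absurd h4.2 h2
    · exact absurd h4.2 h2
    · rw [h4.1, h5.1]; exact hzo.ne'
    · exact absurd h1 h5.2
  · rcases hz (i + l) (by omega) with h4 | h4 <;> rcases hz (j + l) (by omega) with h5 | h5
    · rw [h4.1, h5.1]
    · exfalso
      rcases hl.lt_or_eq with hl | rfl
      · exact h5.2 (h3 l hl h4.2)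
      · exact h2 h4.2
    · rw [h4.1, h5.1]; exact hzo.le
    · rw [h4.1, h5.1]

theorem isNice_binWord_of_max (hzo : z < o) (hS : ∀ n ∈ S, n < a) (h2 : 2 ≤ a) (hp : 0 < p)
    (hpa : 2 * p ≤ a)
    (hmax : ∀ j < a, j ≠ 0 → ∃ n < a, OnePos S a (0 + n) ∧ ¬ OnePos S a (j + n) ∧
      ∀ l < n, OnePos S a (j + l) → OnePos S a (0 + l))
    (hmin : ∀ j < a, j ≠ p → ∃ n < a, OnePos S a (j + n) ∧ ¬ OnePos S a (p + n) ∧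
      ∀ l < n, OnePos S a (p + l) → OnePos S a (j + l)) : IsNice (binWord z o S a) := by
  have hl : (binWord z o S a).length = a := length_binWord
  have ha : 0 < (binWord z o S a).length := by omega
  have hper : ∀ n, powSeq _ ha (n + a) = powSeq _ ha n := fun n => by
    conv_rhs => rw [← powSeq_add_length, hl]
  have h1 := binWord_max ha (by omega) hzo hS hmax
  have h3 := binWord_min ha (by omega) hzo hS hmin
  refine isNice_of_niceSeq_le (p := p) ha (by omega) ?_
  rw [hl]
  exact ⟨primPeriodic_of_forall_lt hper (by omega) fun j hj hj0 => (h1 j hj hj0).imp fun _ => And.left,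
    extreme_of_forall_lt (r := (· ≤ ·)) (fun _ => le_rfl) hper (by omega) h1,
    extreme_of_forall_lt (r := (· ≥ ·)) (fun _ => le_rfl) hper (by omega) h3,
    hp, hpa⟩

theorem isNice_binWord_of_min (hzo : z < o) (hS : ∀ n ∈ S, n < a) (h2 : 2 ≤ a) (hp : 0 < p)
    (hpa : 2 * p < a)
    (hmin : ∀ j < a, j ≠ 0 → ∃ n < a, OnePos S a (j + n) ∧ ¬ OnePos S a (0 + n) ∧
      ∀ l < n, OnePos S a (0 + l) → OnePos S a (j + l))
    (hmax : ∀ j < a, j ≠ p → ∃ n < a, OnePos S a (p + n) ∧ ¬ OnePos S a (j + n) ∧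
      ∀ l < n, OnePos S a (j + l) → OnePos S a (p + l)) : IsNice (binWord z o S a) := by
  have hl : (binWord z o S a).length = a := length_binWord
  have ha : 0 < (binWord z o S a).length := by omega
  have hper : ∀ n, powSeq _ ha (n + a) = powSeq _ ha n := fun n => by
    conv_rhs => rw [← powSeq_add_length, hl]
  have h1 := binWord_min ha (by omega) hzo hS hmin
  have h3 := binWord_max ha (by omega) hzo hS hmax
  refine isNice_of_niceSeq_ge (p := p) ha (by omega) ?_ (by omega)
  rw [hl]
  exact ⟨primPeriodic_of_forall_lt hper (by omega) fun j hj hj0 => (h1 j hj hj0).imp fun _ => And.left,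
    extreme_of_forall_lt (r := (· ≥ ·)) (fun _ => le_rfl) hper (by omega) h1,
    extreme_of_forall_lt (r := (· ≤ ·)) (fun _ => le_rfl) hper (by omega) h3,
    hp, hpa.le⟩

variable {m : ℕ}

/-- The nice rotation `0 ^ m A 1` of the word `AB`, where `A = 1 0 ^ (m - 1)` and `B = 1 0 ^ m`. -/
theorem isNice_AB (hzo : z < o) (hm : 0 < m) : IsNice (binWord z o {m, 2 * m} (2 * m + 1)) := by
  refine isNice_binWord_of_min (p := m) hzo ?_ (by omega) hm (by omega) ?_ ?_ <;>
    simp only [OnePos, Finset.mem_insert, Finset.mem_singleton]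
  · omega
  · intro j hj hj0
    rcases le_or_gt j m with h | h
    · exact ⟨m - j, by omega, by omega, by omega, fun l hl => by omega⟩
    · exact ⟨2 * m - j, by omega, by omega, by omega, fun l hl => by omega⟩
  · intro j hj hj0
    by_cases h : j = 2 * m
    · exact ⟨m, by omega, by omega, by omega, fun l hl => by omega⟩
    · exact ⟨0, by omega, by omega, by omega, fun l hl => by omega⟩

theorem isNice_ABB (hzo : z < o) (hm : 0 < m) :
    IsNice (binWord z o {0, m, 2 * m + 1} (3 * m + 2)) := by
  refine isNice_binWord_of_max (p := m + 1) hzo ?_ (by omega) (by omega) (by omega) ?_ ?_ <;>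
    simp only [OnePos, Finset.mem_insert, Finset.mem_singleton]
  · omega
  · intro j hj hj0
    by_cases h : j = m ∨ j = 2 * m + 1
    · exact ⟨m, by omega, by omega, by omega, fun l hl => by omega⟩
    · exact ⟨0, by omega, by omega, by omega, fun l hl => by omega⟩
  · intro j hj hj0
    by_cases h : j = 2 * m + 2
    · exact ⟨2 * m, by omega, by omega, by omega, fun l hl => by omega⟩
    · obtain ⟨n, hn⟩ : ∃ n, n < m ∧ (j + n = 0 ∨ j + n = m ∨ j + n = 2 * m + 1 ∨ j + n = 3 * m + 2) := by
        rcases le_or_gt j m with h1 | h1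
        · rcases Nat.eq_zero_or_pos j with h2 | h2
          · exact ⟨0, by omega⟩
          · exact ⟨m - j, by omega⟩
        · rcases le_or_gt j (2 * m + 1) with h2 | h2
          · exact ⟨2 * m + 1 - j, by omega⟩
          · exact ⟨3 * m + 2 - j, by omega⟩
      exact ⟨n, by omega, by omega, by omega, fun l hl => by omega⟩

/-- The nice rotation `0 ^ m B A B A 1` of the word `BABAB`. -/
theorem isNice_BABAB (hzo : z < o) (hm : 0 < m) :
    IsNice (binWord z o {m, 2 * m + 1, 3 * m + 1, 4 * m + 2, 5 * m + 2} (5 * m + 3)) := by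
  refine isNice_binWord_of_min (p := 2 * m + 1) hzo ?_ (by omega) (by omega) (by omega) ?_ ?_ <;>
    simp only [OnePos, Finset.mem_insert, Finset.mem_singleton]
  · omega
  · intro j hj hj0
    by_cases h : j = m + 1 ∨ j = 3 * m + 2
    · exact ⟨2 * m, by omega, by omega, by omega, fun l hl => by omega⟩
    · obtain ⟨n, hn⟩ : ∃ n, n < m ∧ (j + n = m ∨ j + n = 2 * m + 1 ∨ j + n = 3 * m + 1 ∨
          j + n = 4 * m + 2 ∨ j + n = 5 * m + 2) := by
        rcases le_or_gt j m with h1 | h1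
        · exact ⟨m - j, by omega⟩
        rcases le_or_gt j (2 * m + 1) with h2 | h2
        · exact ⟨2 * m + 1 - j, by omega⟩
        rcases le_or_gt j (3 * m + 1) with h3 | h3
        · exact ⟨3 * m + 1 - j, by omega⟩
        rcases le_or_gt j (4 * m + 2) with h4 | h4
        · exact ⟨4 * m + 2 - j, by omega⟩
        · exact ⟨5 * m + 2 - j, by omega⟩
      exact ⟨n, by omega, by omega, by omega, fun l hl => by omega⟩
  · intro j hj hj0
    by_cases h : j = 4 * m + 2
    · exact ⟨3 * m + 1, by omega, by omega, by omega, fun l hl => by omega⟩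
    by_cases h' : j = m ∨ j = 3 * m + 1 ∨ j = 5 * m + 2
    · exact ⟨m, by omega, by omega, by omega, fun l hl => by omega⟩
    · exact ⟨0, by omega, by omega, by omega, fun l hl => by omega⟩

theorem isNice_ABABBB (hzo : z < o) (hm : 0 < m) :
    IsNice (binWord z o {0, m, 2 * m + 1, 3 * m + 1, 4 * m + 2, 5 * m + 3} (6 * m + 4)) := by
  refine isNice_binWord_of_max (p := 3 * m + 2) hzo ?_ (by omega) (by omega) (by omega) ?_ ?_ <;>
    simp only [OnePos, Finset.mem_insert, Finset.mem_singleton]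
  · omega
  · intro j hj hj0
    by_cases h : j = 2 * m + 1
    · exact ⟨3 * m + 1, by omega, by omega, by omega, fun l hl => by omega⟩
    by_cases h' : j = m ∨ j = 3 * m + 1 ∨ j = 4 * m + 2 ∨ j = 5 * m + 3
    · exact ⟨m, by omega, by omega, by omega, fun l hl => by omega⟩
    · exact ⟨0, by omega, by omega, by omega, fun l hl => by omega⟩
  · intro j hj hj0
    by_cases h : j = m + 1 ∨ j = 5 * m + 4
    · exact ⟨2 * m, by omega, by omega, by omega, fun l hl => by omega⟩
    by_cases h' : j = 4 * m + 3
    · exact ⟨3 * m + 1, by omega, by omega, by omega, fun l hl => by omega⟩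
    · obtain ⟨n, hn⟩ : ∃ n, n < m ∧ (j + n = 0 ∨ j + n = m ∨ j + n = 2 * m + 1 ∨ j + n = 3 * m + 1 ∨
          j + n = 4 * m + 2 ∨ j + n = 5 * m + 3 ∨ j + n = 6 * m + 4) := by
        rcases Nat.eq_zero_or_pos j with h0 | h0
        · exact ⟨0, by omega⟩
        rcases le_or_gt j m with h1 | h1
        · exact ⟨m - j, by omega⟩
        rcases le_or_gt j (2 * m + 1) with h2 | h2
        · exact ⟨2 * m + 1 - j, by omega⟩
        rcases le_or_gt j (3 * m + 1) with h3 | h3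
        · exact ⟨3 * m + 1 - j, by omega⟩
        rcases le_or_gt j (4 * m + 2) with h4 | h4
        · exact ⟨4 * m + 2 - j, by omega⟩
        rcases le_or_gt j (5 * m + 3) with h5 | h5
        · exact ⟨5 * m + 3 - j, by omega⟩
        · exact ⟨6 * m + 4 - j, by omega⟩
      exact ⟨n, by omega, by omega, by omega, fun l hl => by omega⟩

/-- Words of distinct lengths over two letters, with prescribed overlaps `e i` that are found at the
positions `s i` of their infinite powers, give a cycle of the required kind. The string `x i` is cut
off after the overlap, and `t i` more periods are put before it to make it long enough. -/
theorem exists_isNiceFamily_binWord {k : ℕ} {S : Fin k → Finset ℕ} {a s e : Fin k → ℕ}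
    (t : Fin k → ℕ) (ha : Function.Injective a)
    (hnice : ∀ i, IsNice (binWord z o (S i) (a i))) (hS : ∀ i, ∀ n ∈ S i, n < a i)
    (hel : ∀ i, e i ≤ s (finRotate k i) + e (finRotate k i) + a (finRotate k i) * t (finRotate k i))
    (hal : ∀ i, a i ≤ s i + e i + a i * t i) (hsa : ∀ i, s i + e i ≤ 3 * a i)
    (hea : ∀ i, e i ≤ 3 * a (finRotate k i))
    (hmatch : ∀ i, ∀ n < e i,
      OnePos (S i) (a i) (s i + n) ↔ OnePos (S (finRotate k i)) (a (finRotate k i)) n) :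
    ∃ w x : Fin k → List α, IsNiceFamily w x ∧ (∀ i, (w i).length ≤ (x i).length) ∧
      totalPeriod x = ∑ i, a i ∧ ∀ i, e i ≤ overlapWeight (x i) (x (finRotate k i)) := by
  have hpos : ∀ i, 0 < (binWord z o (S i) (a i)).length := fun i => by have := (hnice i).1; omega
  have hlen : ∀ i, (binWord z o (S i) (a i)).length ≤
      (powPrefix _ (hpos i) (s i + e i + a i * t i)).length := fun i => by
    rw [length_powPrefix, length_binWord]
    exact hal i
  refine ⟨fun i => binWord z o (S i) (a i), fun i => powPrefix _ (hpos i) (s i + e i + a i * t i),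
    ⟨hnice, fun i j hij h => hij (ha ?_), fun i => isWString_powPrefix _ _⟩, hlen, ?_, fun i => ?_⟩
  · simpa [length_binWord] using h.perm.length_eq
  · refine Finset.sum_congr rfl fun i _ => ?_
    rw [period_eq (hnice i) (isWString_powPrefix _ _) (hlen i), length_binWord]
  · exact le_overlapWeight_binWord _ _ (hS _) (hS _) _ (hel i) (hsa i) (hea i) (hmatch i)

theorem exists_tight_two (hzo : z < o) (hm : 0 < m) :
    ∃ w x : Fin 2 → List α, IsNiceFamily w x ∧ (∀ i, (w i).length ≤ (x i).length) ∧
      totalPeriod x = 5 * m + 3 ∧ 4 * m + 1 ≤ overlapWeight (x 0) (x 1) ∧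
      3 * m + 1 ≤ overlapWeight (x 1) (x 0) := by
  obtain ⟨w, x, h1, h2, h3, h4⟩ := exists_isNiceFamily_binWord (z := z) (o := o)
    (S := ![{0, m, 2 * m + 1}, {m, 2 * m}]) (a := ![3 * m + 2, 2 * m + 1])
    (s := ![2 * m + 2, m]) (e := ![4 * m + 1, 3 * m + 1]) ![0, 0]
    (by
      intro i j h
      fin_cases i <;> fin_cases j <;> first | rfl | (exfalso; simp at h; omega))
    (Fin.forall_fin_two.2 ⟨isNice_ABB hzo hm, isNice_AB hzo hm⟩)
    (Fin.forall_fin_two.2 ⟨by simp; omega, by simp; omega⟩)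
    (Fin.forall_fin_two.2 ⟨by simp; omega, by simp; omega⟩)
    (Fin.forall_fin_two.2 ⟨by simp; omega, by simp; omega⟩)
    (Fin.forall_fin_two.2 ⟨by simp; omega, by simp; omega⟩)
    (Fin.forall_fin_two.2 ⟨by simp; omega, by simp; omega⟩)
    (Fin.forall_fin_two.2 ⟨fun n (hn : n < 4 * m + 1) => show
        OnePos {0, m, 2 * m + 1} (3 * m + 2) (2 * m + 2 + n) ↔ OnePos {m, 2 * m} (2 * m + 1) n by
        simp only [OnePos, Finset.mem_insert, Finset.mem_singleton]; omega,
      fun n (hn : n < 3 * m + 1) => show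
        OnePos {m, 2 * m} (2 * m + 1) (m + n) ↔ OnePos {0, m, 2 * m + 1} (3 * m + 2) n by
        simp only [OnePos, Finset.mem_insert, Finset.mem_singleton]; omega⟩)
  refine ⟨w, x, h1, h2, ?_, h4 0, h4 1⟩
  rw [h3, Fin.sum_univ_two]
  simp
  omega

/-- The common factor `0 ^ m B A B A B B A` of the infinite powers. Here and below, the next letters
differ since `B = A 0` stands against `A`, with a `1` to follow. -/
theorem onePos_ABABBB_iff {n : ℕ} (hn : n < 8 * m + 4) :
    OnePos {0, m, 2 * m + 1, 3 * m + 1, 4 * m + 2, 5 * m + 3} (6 * m + 4) (4 * m + 3 + n) ↔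
      OnePos {m, 2 * m + 1, 3 * m + 1, 4 * m + 2, 5 * m + 2} (5 * m + 3) n := by
  simp only [OnePos, Finset.mem_insert, Finset.mem_singleton]
  omega

theorem onePos_BABAB_iff {n : ℕ} (hn : n < 6 * m + 2) :
    OnePos {m, 2 * m + 1, 3 * m + 1, 4 * m + 2, 5 * m + 2} (5 * m + 3) (m + 1 + n) ↔
      OnePos {m, 2 * m} (2 * m + 1) n := by
  simp only [OnePos, Finset.mem_insert, Finset.mem_singleton]
  omega

theorem onePos_AB_iff {n : ℕ} (hn : n < 5 * m + 2) :
    OnePos {m, 2 * m} (2 * m + 1) (m + n) ↔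
      OnePos {0, m, 2 * m + 1, 3 * m + 1, 4 * m + 2, 5 * m + 3} (6 * m + 4) n := by
  simp only [OnePos, Finset.mem_insert, Finset.mem_singleton]
  omega

theorem forall_fin_three {P : Fin 3 → Prop} (h : P 0 ∧ P 1 ∧ P 2) (i : Fin 3) : P i := by
  obtain ⟨h0, h1, h2⟩ := h
  fin_cases i <;> assumption

theorem exists_tight_three (hzo : z < o) (hm : 0 < m) :
    ∃ w x : Fin 3 → List α, IsNiceFamily w x ∧ (∀ i, (w i).length ≤ (x i).length) ∧
      totalPeriod x = 13 * m + 8 ∧ 8 * m + 4 ≤ overlapWeight (x 0) (x 1) ∧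
      6 * m + 2 ≤ overlapWeight (x 1) (x 2) ∧ 5 * m + 2 ≤ overlapWeight (x 2) (x 0) := by
  obtain ⟨w, x, h1, h2, h3, h4⟩ := exists_isNiceFamily_binWord (z := z) (o := o)
    (S := ![{0, m, 2 * m + 1, 3 * m + 1, 4 * m + 2, 5 * m + 3},
      {m, 2 * m + 1, 3 * m + 1, 4 * m + 2, 5 * m + 2}, {m, 2 * m}])
    (a := ![6 * m + 4, 5 * m + 3, 2 * m + 1])
    (s := ![4 * m + 3, m + 1, m]) (e := ![8 * m + 4, 6 * m + 2, 5 * m + 2]) ![0, 1, 0]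
    (by
      intro i j h
      fin_cases i <;> fin_cases j <;> first | rfl | (exfalso; simp at h; omega))
    (forall_fin_three ⟨isNice_ABABBB hzo hm, isNice_BABAB hzo hm, isNice_AB hzo hm⟩)
    (forall_fin_three ⟨by simp; omega, by simp; omega, by simp; omega⟩)
    (forall_fin_three ⟨show 8 * m + 4 ≤ m + 1 + (6 * m + 2) + (5 * m + 3) * 1 by omega,
      show 6 * m + 2 ≤ m + (5 * m + 2) + (2 * m + 1) * 0 by omega,
      show 5 * m + 2 ≤ 4 * m + 3 + (8 * m + 4) + (6 * m + 4) * 0 by omega⟩)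
    (forall_fin_three ⟨by simp; omega, by simp, by simp; omega⟩)
    (forall_fin_three ⟨by simp; omega, by simp; omega, by simp; omega⟩)
    (forall_fin_three ⟨show 8 * m + 4 ≤ 3 * (5 * m + 3) by omega,
      show 6 * m + 2 ≤ 3 * (2 * m + 1) by omega, show 5 * m + 2 ≤ 3 * (6 * m + 4) by omega⟩)
    (forall_fin_three ⟨fun _ => onePos_ABABBB_iff, fun _ => onePos_BABAB_iff,
      fun _ => onePos_AB_iff⟩)
  refine ⟨w, x, h1, h2, ?_, h4 0, h4 1, h4 2⟩
  rw [h3, Fin.sum_univ_three]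
  simp
  omega

end Tight

end Superstring

theorem theorem1 {α : Type*} [LinearOrder α] :
    -- the bound, for every cycle `x (c 0) → x (c 1) → ⋯ → x (c (k - 1)) → x (c 0)`
    (∀ (ι : Type*) (w x : ι → List α), Superstring.IsNiceFamily w x →
      ∀ (k : ℕ) (c : Fin k → ι), 2 ≤ k → Function.Injective c →
        2 * Superstring.minOverlap (x ∘ c) + 7 * Superstring.totalOverlap (x ∘ c)
            ≤ 11 * ∑ i, (w (c i)).length ∧
        ((∀ i, (w (c i)).length ≤ (x (c i)).length) →
          2 * Superstring.minOverlap (x ∘ c) + 7 * Superstring.totalOverlap (x ∘ c)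
            ≤ 11 * Superstring.totalPeriod (x ∘ c))) ∧
    -- the bound is attained up to an additive constant by arbitrarily long cycles
    (Nontrivial α → ∀ k : ℕ, k = 2 ∨ k = 3 →
      ∃ D : ℕ, ∀ N : ℕ, ∃ w x : Fin k → List α,
        Superstring.IsNiceFamily w x ∧
        (∀ i, (w i).length ≤ (x i).length) ∧
        N ≤ Superstring.totalPeriod x ∧
        11 * Superstring.totalPeriod x
          ≤ 2 * Superstring.minOverlap x + 7 * Superstring.totalOverlap x + D) := by
  refine ⟨fun ι w x H k c hk hc => ?_, fun _ k hk => ?_⟩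
  · have h1 := Superstring.bound_of_isNiceFamily H hk hc
    refine ⟨h1, fun hle => ?_⟩
    have h2 : Superstring.totalPeriod (x ∘ c) = ∑ i, (w (c i)).length :=
      Finset.sum_congr rfl fun i _ => Superstring.period_eq (H.nice _) (H.wstring _) (hle i)
    rwa [h2]
  · obtain ⟨z, o, hzo⟩ := exists_pair_lt α
    rcases hk with rfl | rfl
    · refine ⟨17, fun N => ?_⟩
      obtain ⟨w, x, h1, h2, h3, h4, h5⟩ := Superstring.exists_tight_two hzo N.succ_pos
      have h6 : Superstring.totalOverlap x = Superstring.overlapWeight (x 0) (x 1) +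
          Superstring.overlapWeight (x 1) (x 0) := Fin.sum_univ_two _
      have h7 : 3 * N.succ + 1 ≤ Superstring.minOverlap x :=
        le_ciInf (Fin.forall_fin_two.2 ⟨le_trans (by omega) h4, h5⟩)
      exact ⟨w, x, h1, h2, by omega, by omega⟩
    · refine ⟨28, fun N => ?_⟩
      obtain ⟨w, x, h1, h2, h3, h4, h5, h6⟩ := Superstring.exists_tight_three hzo N.succ_pos
      have h7 : Superstring.totalOverlap x = Superstring.overlapWeight (x 0) (x 1) +
          Superstring.overlapWeight (x 1) (x 2) + Superstring.overlapWeight (x 2) (x 0) :=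
        Fin.sum_univ_three _
      have h8 : 5 * N.succ + 2 ≤ Superstring.minOverlap x :=
        le_ciInf (Superstring.forall_fin_three ⟨le_trans (by omega) h4, le_trans (by omega) h5, h6⟩)
      exact ⟨w, x, h1, h2, by omega, by omega⟩
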